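/- Let $k$ be a local field of characteristic $0$, let $G$ be a linear algebraic group over $k$, let $H\subseteq G$ be an algebraic subgroup defined over $k$, let $N$ be a normal algebraic subgroup of $H$ defined over $k$, and let $\varphi\colon H\to Q=H/N$ be the quotient homomorphism. A one parameter algebraic unipotent subgroup of $G(k)$ is a subgroup of the form $U(k)$, where $U$ is a unipotent algebraic subgroup of $G$ defined over $k$ and of dimension at most one. For a subgroup $L$ of $G(k)$, let $L^+$ be the subgroup generated by the one parameter algebraic unipotent subgroups of $G(k)$ that are contained in $L$; in particular this defines $G(k)^+$. The same definitions apply to $H$ and to $Q$ in place of $G$. Then: 1. $H(k)^+\subseteq G(k)^+\cap H(k)$; 2. $Q(k)^+\subseteq\varphi\left(H(k)^+\right)$; 3. if $W$ is a subgroup of $H(k)$ that contains $N(k)$ and satisfies $W^+\subseteq N(k)$, then $\varphi(W)^+$ is the trivial subgroup of $Q(k)$. -/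

import Mathlib

/-!
Linear algebraic groups over a field `k` are represented by their coordinate rings: the affine
algebraic group `G` corresponds to the commutative Hopf algebra `A = k[G]`, finitely generated as
a `k`-algebra. A homomorphism `H → G` corresponds to a bialgebra homomorphism `k[G] → k[H]`, and
closed subgroups correspond to surjective bialgebra homomorphisms, or to Hopf ideals.
-/

universe u v

open scoped TensorProduct

namespace AlgGrp

noncomputable section

/-- The `R`-points `G(R) = Hom_k(k[G], R)` of the affine group `G` with coordinate ring `A`. The
convolution product of `WithConv` is the group law of `G(R)`. -/
abbrev Points (k : Type v) (A : Type u) (R : Type*) [CommSemiring k] [CommSemiring A]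
    [CommSemiring R] [Algebra k A] [Algebra k R] : Type _ :=
  WithConv (A →ₐ[k] R)

/-- The homomorphism `H(R) → G(R)`, `h ↦ h ∘ f`, induced by the homomorphism of groups `H → G`
which corresponds to the bialgebra homomorphism `f : k[G] → k[H]`. -/
def pointsMap {k : Type v} {A B : Type u} [Field k] [CommRing A] [CommRing B]
    [HopfAlgebra k A] [HopfAlgebra k B] (f : A →ₐc[k] B)
    (R : Type*) [CommRing R] [Algebra k R] : Points k B R →* Points k A R where
  toFun h := WithConv.toConv (h.ofConv.comp (f : A →ₐ[k] B))
  map_one' := by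
    apply WithConv.ext
    ext a
    simp [AlgHom.convOne_def]
  map_mul' g h := by
    apply WithConv.ext
    exact AlgHom.convMul_comp_bialgHom_distrib g h f

/-- The right translation operator `ρ_g : k[G] → k[G]`, `(ρ_g f)(x) = f (x g)`, for `g ∈ G(k)`. -/
def rightTranslation {k : Type v} {A : Type u} [Field k] [CommRing A] [HopfAlgebra k A]
    (g : Points k A k) : A →ₗ[k] A :=
  (TensorProduct.rid k A).toLinearMap ∘ₗ
    g.ofConv.toLinearMap.lTensor A ∘ₗ Coalgebra.comul

/-- An element `g ∈ G(k)` is unipotent if right translation by `g` on `k[G]` is locally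
unipotent. -/
def IsUnipotentElement {k : Type v} {A : Type u} [Field k] [CommRing A] [HopfAlgebra k A]
    (g : Points k A k) : Prop :=
  ∀ a : A, ∃ n : ℕ, ((rightTranslation g - 1) ^ n) a = 0

/-- The algebraic group with coordinate ring `A` is unipotent if every element of its group of
points over an algebraic closure `K` of `k` is unipotent. (The points over `K` are those of the
base change, whose coordinate ring is `K ⊗ A`.) -/
def IsUnipotentGroup (k : Type v) (A : Type u) [Field k] [CommRing A] [HopfAlgebra k A] : Prop :=
  ∀ g : Points (AlgebraicClosure k) (AlgebraicClosure k ⊗[k] A) (AlgebraicClosure k),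
    IsUnipotentElement g

/-- One parameter algebraic unipotent subgroups of `G(k)`: the subgroups of the form `U(k)`, for
`U` a unipotent algebraic subgroup of `G` defined over `k`, of dimension at most one. -/
def IsOneParamUnipotent {k : Type v} {A : Type u} [Field k] [CommRing A] [HopfAlgebra k A]
    (S : Subgroup (Points k A k)) : Prop :=
  ∃ (I : Ideal A) (_ : I.IsHopfIdeal k),
    IsUnipotentGroup k (A ⧸ I) ∧ ringKrullDim (A ⧸ I) ≤ 1 ∧
      S = (pointsMap (Bialgebra.Quotient.mkBialgHom (R := k) I) k).range

/-- For a subgroup `L` of `G(k)`, the subgroup `L⁺` generated by the one parameter algebraic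
unipotent subgroups of `G(k)` that are contained in `L`. -/
def plus {k : Type v} {A : Type u} [Field k] [CommRing A] [HopfAlgebra k A]
    (L : Subgroup (Points k A k)) : Subgroup (Points k A k) :=
  sSup {S | IsOneParamUnipotent S ∧ S ≤ L}

/-- The subgroup `G(k)⁺` of `G(k)`, for the algebraic group `G` with coordinate ring `A`. -/
abbrev plusPoints (k : Type v) (A : Type u) [Field k] [CommRing A] [HopfAlgebra k A] :
    Subgroup (Points k A k) :=
  plus ⊤

/-- The closed subgroup `N` of `H` given by `π : k[H] → k[N]` is normal: for every commutative
`k`-algebra `R`, one has `h N(R) ⊆ N(R) h` for all `h` in the group `H(R)`. -/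
def IsNormal {k : Type v} {B C : Type u} [Field k] [CommRing B] [CommRing C]
    [HopfAlgebra k B] [HopfAlgebra k C] (π : B →ₐc[k] C) : Prop :=
  ∀ (R : Type u) [CommRing R] [Algebra k R] (h : Points k B R) (n : Points k C R),
    ∃ n' : Points k C R, h * pointsMap π R n = pointsMap π R n' * h

/-- The homomorphism `H → Q` corresponding to `φ : k[Q] → k[H]` is a quotient homomorphism with
kernel the subgroup `N` of `H` given by `π : k[H] → k[N]`; that is, `Q = H / N`.

A homomorphism of affine groups over a field is a quotient homomorphism (equivalently, faithfully
flat; equivalently for algebraic groups in characteristic zero, surjective over an algebraic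
closure) when it is injective on coordinate rings. Its kernel, the fibre over the neutral element,
is defined in `H` by the ideal generated by the augmentation ideal of `k[Q]`. -/
structure IsQuotientBy {k : Type v} {B C D : Type u} [Field k] [CommRing B] [CommRing C]
    [CommRing D] [HopfAlgebra k B] [HopfAlgebra k C] [HopfAlgebra k D]
    (φ : D →ₐc[k] B) (π : B →ₐc[k] C) : Prop where
  injective : Function.Injective φ
  ker_eq : RingHom.ker π =
    Ideal.map φ (RingHom.ker (Bialgebra.counitAlgHom k D))

end

end AlgGrp

/-! The core is a lifting statement in characteristic zero, `IsOneParamUnipotent.exists_lift`: each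
element `q` of a one parameter unipotent subgroup `S` of `Q(k)` lies in the image of a one parameter
unipotent subgroup `S'` of `H(k)` whose whole image is inside `S`. Claim 2 is then immediate. For
claim 3, if `S ≤ φ(W)`, every element of `S'` differs from an element of `W` by an element of the
kernel, which is contained in `N(k) ≤ W`; so `S' ≤ W`, hence `S' ≤ W⁺ ≤ N(k)` and `q = 1`. Claim 1
only needs that a Hopf ideal of `k[H]` pulls back along the surjection `k[G] → k[H]` to a Hopf ideal
with the same quotient ring.

To lift `q`: unipotence makes `j ↦ a(qʲ)` polynomial for every regular function `a`, so the powers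
of `q` interpolate to a one parameter subgroup `lam : k[Q] → k[t]` passing through `q` at `t = 1`.
Its generator `T` is a locally nilpotent left invariant derivation of `k[Q]`. In characteristic zero
its tangent vector lifts to `H` (`IsExponential.exists_tangent_lift`), which gives a left invariant
derivation `M` of `k[H]` extending `T`.

`M` need not be locally nilpotent, so it is replaced by `N = M - M_s`, where `M_s` is the semisimple
part in the additive Jordan decomposition. `M_s` is again a left invariant derivation, and it
vanishes on `k[Q]` because the semisimple part of `T` is zero; thus `N` still extends `T`.
Exponentiating `N` gives `mu : k[H] → k[t]` with `mu ∘ φ = lam`. The image of this one parameter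
subgroup is trivial or a copy of the additive group. -/

namespace AlgGrp

/-! ### Left invariant operators and linear forms on `k[G]` -/

section LeftInvariant

open Coalgebra WithConv

variable {k : Type v} {A : Type u} [Field k] [CommRing A] [HopfAlgebra k A]

/-- The left invariant operator `a ↦ ∑ f(a₂) a₁` on `k[G]` given by a linear form `f`. -/
noncomputable def leftInvariantOp (f : A →ₗ[k] k) : A →ₗ[k] A :=
  (TensorProduct.rid k A).toLinearMap ∘ₗ f.lTensor A ∘ₗ comul

theorem leftInvariantOp_apply (f : A →ₗ[k] k) {a : A} {κ : Type*} (r : Coalgebra.Repr k a κ) :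
    leftInvariantOp f a = ∑ i ∈ r.index, f (r.right i) • r.left i := by
  simp [leftInvariantOp, ← r.eq]

theorem counit_leftInvariantOp (f : A →ₗ[k] k) (a : A) :
    counit (R := k) (leftInvariantOp f a) = f a := by
  conv_rhs => rw [← sum_counit_smul (ℛ k a)]
  rw [leftInvariantOp_apply f (ℛ k a)]
  simp [mul_comm]

theorem comul_leftInvariantOp (f : A →ₗ[k] k) (a : A) :
    comul (R := k) (leftInvariantOp f a) = (leftInvariantOp f).lTensor A (comul (R := k) a) := by
  have h := congr((TensorProduct.rid k (A ⊗[k] A)) (f.lTensor (A ⊗[k] A)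
    ((TensorProduct.assoc k A A A).symm $(coassoc_apply (R := k) a))))
  rw [LinearEquiv.symm_apply_apply] at h
  have h1 : (TensorProduct.rid k (A ⊗[k] A)).toLinearMap ∘ₗ f.lTensor (A ⊗[k] A) ∘ₗ
      (comul (R := k) (A := A)).rTensor A =
      comul ∘ₗ (TensorProduct.rid k A).toLinearMap ∘ₗ f.lTensor A := by
    ext; simp
  have h2 : (TensorProduct.rid k (A ⊗[k] A)).toLinearMap ∘ₗ f.lTensor (A ⊗[k] A) ∘ₗ
      (TensorProduct.assoc k A A A).symm.toLinearMap =
      ((TensorProduct.rid k A).toLinearMap ∘ₗ f.lTensor A).lTensor A := by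
    ext; simp
  calc _ = _ := (congr($h1 (comul a))).symm
    _ = _ := h
    _ = _ := congr($h2 (comul.lTensor A (comul a)))
    _ = _ := by rw [← LinearMap.comp_apply, ← LinearMap.lTensor_comp]; rfl

/-- Applying `id ⊗ counit` to the invariance identity recovers `N` from its value at the neutral
element. Invariant operators can therefore be compared through linear forms alone. -/
theorem eq_leftInvariantOp {N : A →ₗ[k] A} (hN : comul ∘ₗ N = N.lTensor A ∘ₗ comul) :
    N = leftInvariantOp (counit ∘ₗ N) := by
  ext a
  have h := congr(TensorProduct.rid k A ((counit (R := k)).lTensor A ($hN a)))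
  simpa [leftInvariantOp, LinearMap.lTensor_comp] using h

theorem leftInvariantOp_convMul (f g : WithConv (A →ₗ[k] k)) :
    leftInvariantOp (f * g).ofConv = leftInvariantOp f.ofConv ∘ₗ leftInvariantOp g.ofConv := by
  have h : comul ∘ₗ (leftInvariantOp f.ofConv ∘ₗ leftInvariantOp g.ofConv) =
      (leftInvariantOp f.ofConv ∘ₗ leftInvariantOp g.ofConv).lTensor A ∘ₗ comul := by
    ext a
    simp [comul_leftInvariantOp, LinearMap.lTensor_comp]
  rw [eq_leftInvariantOp h]
  congr 1
  ext a
  rw [(ℛ k a).convMul_apply]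
  simp [counit_leftInvariantOp, leftInvariantOp_apply _ (ℛ k a), mul_comm]

theorem leftInvariantOp_counit : leftInvariantOp (counit (R := k) (A := A)) = LinearMap.id := by
  have h : comul ∘ₗ LinearMap.id = (LinearMap.id (R := k) (M := A)).lTensor A ∘ₗ comul := by
    ext a; simp
  exact (eq_leftInvariantOp h).symm

theorem bialgHom_leftInvariantOp {B : Type u} [CommRing B] [HopfAlgebra k B] (φ : A →ₐc[k] B)
    (f : B →ₗ[k] k) (a : A) :
    φ (leftInvariantOp (f ∘ₗ (φ : A →ₐ[k] B).toLinearMap) a) = leftInvariantOp f (φ a) := by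
  have h : comul (R := k) (φ a) = TensorProduct.map (φ : A →ₗ[k] B) (φ : A →ₗ[k] B) (comul a) :=
    (CoalgHomClass.map_comp_comul_apply φ a).symm
  simp [leftInvariantOp, h, ← (ℛ k a).eq]

end LeftInvariant

/-! ### Groups of points, change of coefficients and base change -/

section Points

open Coalgebra WithConv

variable {k : Type v} {A : Type u} [Field k] [CommRing A] [HopfAlgebra k A]
  {R : Type*} [CommRing R] [Algebra k R]

theorem Points.mul_apply (g h : Points k A R) {a : A} {κ : Type*} (r : Coalgebra.Repr k a κ) :
    (g * h).ofConv a = ∑ i ∈ r.index, g.ofConv (r.left i) * h.ofConv (r.right i) := by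
  have := AlgHom.convMul_apply g h a
  rw [← r.eq] at this
  simpa using this

theorem Points.one_apply (a : A) :
    (1 : Points k A R).ofConv a = algebraMap k R (counit a) := rfl

theorem pointsMap_apply {B : Type u} [CommRing B] [HopfAlgebra k B] (f : A →ₐc[k] B)
    (g : Points k B R) (a : A) : (pointsMap f R g).ofConv a = g.ofConv (f a) := rfl

theorem pointsMap_pow_apply {B : Type u} [CommRing B] [HopfAlgebra k B] (f : A →ₐc[k] B)
    (g : Points k B R) (j : ℕ) (a : A) : ((pointsMap f R g) ^ j).ofConv a = (g ^ j).ofConv (f a) := by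
  rw [← map_pow, pointsMap_apply]

/-- The homomorphism `G(R) → G(S)` induced by a homomorphism `R → S`. -/
def Points.mapCoeff {S : Type*} [CommRing S] [Algebra k S] (e : R →ₐ[k] S) :
    Points k A R →* Points k A S where
  toFun g := toConv (e.comp g.ofConv)
  map_one' := by
    apply WithConv.ext
    ext a
    simp [AlgHom.convOne_def]
  map_mul' g h := by
    apply WithConv.ext
    exact AlgHom.comp_convMul_distrib e g h

theorem Points.mapCoeff_pow_apply {S : Type*} [CommRing S] [Algebra k S] (e : R →ₐ[k] S)
    (g : Points k A R) (j : ℕ) (a : A) :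
    ((Points.mapCoeff e g) ^ j).ofConv a = e ((g ^ j).ofConv a) := by
  rw [← map_pow]; rfl

/-- The identification of the `K`-points of the base change of `G` to `K` with `G(K)`. -/
noncomputable def Points.ofBaseChange (K : Type*) [Field K] [Algebra k K] :
    Points K (K ⊗[k] A) K →* Points k A K where
  toFun g := toConv ((g.ofConv.restrictScalars k).comp Algebra.TensorProduct.includeRight)
  map_one' := by
    apply WithConv.ext
    ext a
    simp [AlgHom.convOne_def]
  map_mul' g h := by
    apply WithConv.ext
    ext a
    rw [show ofConv (toConv _ * toConv _) = _ from rfl]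
    rw [Points.mul_apply _ _ (ℛ k a)]
    simp only [AlgHom.coe_comp, Function.comp_apply, AlgHom.coe_restrictScalars',
      Algebra.TensorProduct.includeRight_apply]
    have := AlgHom.convMul_apply g h (1 ⊗ₜ[k] a)
    refine this.trans ?_
    rw [TensorProduct.comul_tmul, ← (ℛ k a).eq]
    simp [TensorProduct.tmul_sum]

theorem Points.ofBaseChange_apply {K : Type*} [Field K] [Algebra k K]
    (g : Points K (K ⊗[k] A) K) (a : A) :
    (Points.ofBaseChange K g).ofConv a = g.ofConv (1 ⊗ₜ a) := rfl

theorem Points.ofBaseChange_surjective {K : Type*} [Field K] [Algebra k K] :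
    Function.Surjective (Points.ofBaseChange K : Points K (K ⊗[k] A) K → Points k A K) := by
  intro g
  refine ⟨toConv (Algebra.TensorProduct.lift (Algebra.ofId K K) g.ofConv fun _ _ ↦ .all _ _), ?_⟩
  apply WithConv.ext
  ext a
  rw [Points.ofBaseChange_apply]
  simp

end Points

/-! ### Unipotent elements as those with polynomial powers -/

section Unipotent

open Coalgebra WithConv Polynomial

variable {k : Type v} {A : Type u} [Field k] [CommRing A] [HopfAlgebra k A]

theorem rightTranslation_pow (g : Points k A k) (j : ℕ) :
    rightTranslation g ^ j = leftInvariantOp (g ^ j).ofConv.toLinearMap := by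
  induction j with
  | zero =>
    rw [pow_zero, pow_zero]
    exact leftInvariantOp_counit.symm
  | succ j ih =>
    rw [pow_succ, pow_succ, ih]
    exact (leftInvariantOp_convMul (toConv (g ^ j).ofConv.toLinearMap)
      (toConv g.ofConv.toLinearMap)).symm

theorem counit_rightTranslation_pow (g : Points k A k) (j : ℕ) (a : A) :
    counit (R := k) ((rightTranslation g ^ j) a) = (g ^ j).ofConv a := by
  rw [rightTranslation_pow, counit_leftInvariantOp]; rfl

theorem sub_one_pow_apply {M : Type*} [AddCommGroup M] [Module k M] (ρ : Module.End k M) (n : ℕ)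
    (a : M) : ((ρ - 1) ^ n) a =
      ∑ j ∈ Finset.range (n + 1), ((-1 : ℤ) ^ (n - j) * n.choose j) • (ρ ^ j) a := by
  rw [sub_eq_add_neg, ((Commute.one_right ρ).neg_right).add_pow, LinearMap.sum_apply]
  refine Finset.sum_congr rfl fun j _ ↦ ?_
  have : ρ ^ j * (-1) ^ (n - j) * (n.choose j : Module.End k M) =
      ((-1 : ℤ) ^ (n - j) * n.choose j) • ρ ^ j := by
    rw [zsmul_eq_mul, mul_assoc]
    push_cast
    exact (((Commute.one_right (ρ ^ j)).neg_right.pow_right _).mul_right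
      (Nat.commute_cast _ _)).eq
  rw [this, LinearMap.smul_apply]

theorem pow_apply_eq_sum_choose {M : Type*} [AddCommGroup M] [Module k M] (ρ : Module.End k M)
    {n : ℕ} {a : M} (h : ((ρ - 1) ^ n) a = 0) (j : ℕ) :
    (ρ ^ j) a = ∑ i ∈ Finset.range n, (j.choose i) • ((ρ - 1) ^ i) a := by
  have h1 : (ρ ^ j) a = ∑ i ∈ Finset.range (j + 1), (j.choose i) • ((ρ - 1) ^ i) a := by
    conv_lhs => rw [← sub_add_cancel ρ 1, (Commute.one_right (ρ - 1)).add_pow, LinearMap.sum_apply]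
    simp [← Nat.cast_smul_eq_nsmul k, Module.End.mul_apply]
  have h2 : ∀ i, n ≤ i → ((ρ - 1) ^ i) a = 0 := by
    intro i hi
    rw [← Nat.sub_add_cancel hi, pow_add, Module.End.mul_apply, h, map_zero]
  rw [h1]
  trans ∑ i ∈ Finset.range (j + 1 + n), (j.choose i) • ((ρ - 1) ^ i) a
  · refine Finset.sum_subset (by simp) fun i _ hi ↦ ?_
    rw [Nat.choose_eq_zero_of_lt (by simpa using hi), zero_smul]
  · refine (Finset.sum_subset (by simp) fun i _ hi ↦ ?_).symm
    rw [h2 i (by simpa using hi), smul_zero]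

/-- An element `g` of `G(k)` is unipotent if and only if `j ↦ a(gʲ)` is a polynomial function for
every regular function `a`. -/
theorem isUnipotentElement_iff [CharZero k] (g : Points k A k) :
    IsUnipotentElement g ↔ ∀ a : A, ∃ P : k[X], ∀ j : ℕ, (g ^ j).ofConv a = P.eval (j : k) := by
  constructor
  · intro h a
    obtain ⟨n, hn⟩ := h a
    -- The falling factorial divided by `i!` is the polynomial in `j` that interpolates the binomial
    -- coefficient in the expansion of `(1 + (ρ - 1))ʲ`.
    refine ⟨∑ i ∈ Finset.range n,
      C (counit (R := k) (((rightTranslation g - 1) ^ i) a) / (i.factorial : k)) *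
        descPochhammer k i, fun j ↦ ?_⟩
    rw [← counit_rightTranslation_pow, pow_apply_eq_sum_choose _ hn, map_sum, eval_finsetSum]
    refine Finset.sum_congr rfl fun i _ ↦ ?_
    rw [eval_mul, eval_C, descPochhammer_eval_eq_descFactorial, Nat.descFactorial_eq_factorial_mul_choose,
      map_nsmul, nsmul_eq_mul, Nat.cast_mul]
    have : (i.factorial : k) ≠ 0 := by exact_mod_cast i.factorial_ne_zero
    field_simp
  · intro h a
    choose P hP using h
    let r := ℛ k a
    let Q : A[X] := ∑ i ∈ r.index, (P (r.right i)).map (algebraMap k A) * C (r.left i)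
    -- `(ρ - 1)ⁿ a` is the `n`-th forward difference at `0` of `j ↦ ρʲ a = Q(j)`, so it vanishes
    -- once `n` exceeds the degree of `Q`.
    refine ⟨Q.natDegree + 1, ?_⟩
    have hQ : ∀ j : ℕ, ((rightTranslation g) ^ j) a = Q.eval (j : A) := by
      intro j
      rw [rightTranslation_pow, leftInvariantOp_apply _ r, eval_finsetSum]
      refine Finset.sum_congr rfl fun i _ ↦ ?_
      have := hP (r.right i) j
      rw [eval_mul, eval_C, ← map_natCast (algebraMap k A) j, eval_map_apply, ← this,
        Algebra.smul_def]
      rfl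
    rw [sub_one_pow_apply]
    simp_rw [hQ]
    have h0 := Q.fwdDiff_iter_degree_add_one_eq_zero
    have := fwdDiff_iter_eq_sum_shift (1 : A) Q.eval (Q.natDegree + 1) 0
    rw [h0] at this
    simpa using this.symm

end Unipotent

/-! ### Hopf ideals and one parameter unipotent subgroups -/

section Unipotent

open Coalgebra WithConv Polynomial

variable {k : Type v} {A : Type u} [Field k] [CommRing A] [HopfAlgebra k A]

theorem isUnipotentGroup_iff [CharZero k] :
    IsUnipotentGroup k A ↔ ∀ (g : Points k A (AlgebraicClosure k)) (a : A),
      ∃ P : (AlgebraicClosure k)[X], ∀ j : ℕ, (g ^ j).ofConv a = P.eval (j : AlgebraicClosure k) := by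
  have : CharZero (AlgebraicClosure k) :=
    charZero_of_injective_algebraMap (algebraMap k (AlgebraicClosure k)).injective
  constructor
  · intro h g a
    obtain ⟨g, rfl⟩ := Points.ofBaseChange_surjective g
    obtain ⟨P, hP⟩ := (isUnipotentElement_iff g).1 (h g) (1 ⊗ₜ a)
    refine ⟨P, fun j ↦ ?_⟩
    rw [← hP, ← map_pow, Points.ofBaseChange_apply]
  · intro h g
    rw [isUnipotentElement_iff]
    intro x
    induction x with
    | zero => exact ⟨0, fun j ↦ by simp⟩
    | add x y hx hy =>
      obtain ⟨P, hP⟩ := hx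
      obtain ⟨Q, hQ⟩ := hy
      exact ⟨P + Q, fun j ↦ by rw [map_add, hP, hQ, eval_add]⟩
    | tmul c a =>
      obtain ⟨P, hP⟩ := h (Points.ofBaseChange _ g) a
      refine ⟨C c * P, fun j ↦ ?_⟩
      rw [eval_mul, eval_C, ← hP, ← map_pow, Points.ofBaseChange_apply, ← smul_eq_mul, ← map_smul,
        TensorProduct.smul_tmul', smul_eq_mul, mul_one]

variable (I : Ideal A) [I.IsHopfIdeal k] {R : Type*} [CommRing R] [Algebra k R]

theorem exists_pointsMap_mk_eq_iff (g : Points k A R) :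
    (∃ h, pointsMap (Bialgebra.Quotient.mkBialgHom (R := k) I) R h = g) ↔
      ∀ x ∈ I, g.ofConv x = 0 := by
  constructor
  · rintro ⟨h, rfl⟩ x hx
    rw [pointsMap_apply, Bialgebra.Quotient.mkBialgHom_apply, Ideal.Quotient.eq_zero_iff_mem.2 hx,
      map_zero]
  · intro h
    exact ⟨toConv (Ideal.Quotient.liftₐ I g.ofConv h), rfl⟩

theorem isUnipotentGroup_quotient_iff [CharZero k] :
    IsUnipotentGroup k (A ⧸ I) ↔ ∀ g : Points k A (AlgebraicClosure k),
      (∀ x ∈ I, g.ofConv x = 0) → ∀ a : A,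
      ∃ P : (AlgebraicClosure k)[X], ∀ j : ℕ, (g ^ j).ofConv a = P.eval (j : AlgebraicClosure k) := by
  rw [isUnipotentGroup_iff]
  constructor
  · intro h g hg a
    obtain ⟨g, rfl⟩ := (exists_pointsMap_mk_eq_iff I g).2 hg
    simp_rw [pointsMap_pow_apply]
    exact h g _
  · intro h g a
    obtain ⟨a, rfl⟩ := Ideal.Quotient.mk_surjective a
    obtain ⟨P, hP⟩ := h _ ((exists_pointsMap_mk_eq_iff I _).1 ⟨g, rfl⟩) a
    refine ⟨P, fun j ↦ ?_⟩
    rw [← hP, pointsMap_pow_apply, Bialgebra.Quotient.mkBialgHom_apply]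

theorem isOneParamUnipotent_iff [CharZero k] {S : Subgroup (Points k A k)} :
    IsOneParamUnipotent S ↔ ∃ I : Ideal A, I.IsHopfIdeal k ∧
      (∀ g : Points k A (AlgebraicClosure k), (∀ x ∈ I, g.ofConv x = 0) → ∀ a : A,
        ∃ P : (AlgebraicClosure k)[X], ∀ j : ℕ, (g ^ j).ofConv a = P.eval (j : AlgebraicClosure k)) ∧
      ringKrullDim (A ⧸ I) ≤ 1 ∧ ∀ g : Points k A k, g ∈ S ↔ ∀ x ∈ I, g.ofConv x = 0 := by
  constructor
  · rintro ⟨I, hI, hU, hd, rfl⟩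
    exact ⟨I, hI, (isUnipotentGroup_quotient_iff I).1 hU, hd, exists_pointsMap_mk_eq_iff I⟩
  · rintro ⟨I, hI, hU, hd, hS⟩
    refine ⟨I, hI, (isUnipotentGroup_quotient_iff I).2 hU, hd, ?_⟩
    ext g
    rw [hS]
    exact (exists_pointsMap_mk_eq_iff I g).symm

/-- `V / ker f` embeds in `M`, and over a field the tensor square of an injection is injective. This
verifies the coideal condition for kernels. -/
theorem map_mkQ_eq_zero_of_map_eq_zero {V M : Type*} [AddCommGroup V] [Module k V]
    [AddCommGroup M] [Module k M] (f : V →ₗ[k] M) {W : Submodule k V} (hW : LinearMap.ker f = W)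
    {z : V ⊗[k] V} (hz : TensorProduct.map f f z = 0) : TensorProduct.map W.mkQ W.mkQ z = 0 := by
  subst hW
  let q := (LinearMap.ker f).liftQ f le_rfl
  have hq : Function.Injective q := by
    rw [← LinearMap.ker_eq_bot]
    exact Submodule.ker_liftQ_eq_bot _ _ _ le_rfl
  have h : TensorProduct.map f f = TensorProduct.map q q ∘ₗ
      TensorProduct.map (LinearMap.ker f).mkQ (LinearMap.ker f).mkQ := by
    rw [← TensorProduct.map_comp]
    rfl
  rw [h, LinearMap.comp_apply] at hz
  exact TensorProduct.map_injective_of_flat_flat q q hq hq (hz.trans (map_zero _).symm)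

theorem Points.antipode_mul (g : Points k A R) :
    toConv (g.ofConv.comp (HopfAlgebra.antipodeAlgHom k A)) * g = 1 := by
  apply WithConv.ext
  ext a
  rw [Points.mul_apply _ _ (ℛ k a), Points.one_apply, ← g.ofConv.commutes,
    ← HopfAlgebra.sum_antipode_mul_eq_algebraMap_counit (ℛ k a)]
  simp

theorem Points.mul_antipode (g : Points k A R) :
    g * toConv (g.ofConv.comp (HopfAlgebra.antipodeAlgHom k A)) = 1 := by
  apply WithConv.ext
  ext a
  rw [Points.mul_apply _ _ (ℛ k a), Points.one_apply, ← g.ofConv.commutes,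
    ← HopfAlgebra.sum_mul_antipode_eq_algebraMap_counit (ℛ k a)]
  simp

/-- Uniqueness of inverses in the group `G(B)`: both sides are inverse to the point `f`, the image
of the universal point `id` of `H(B)`. -/
theorem bialgHom_antipode {B : Type u} [CommRing B] [HopfAlgebra k B] (f : A →ₐc[k] B) (a : A) :
    f (HopfAlgebraStruct.antipode k a) = HopfAlgebraStruct.antipode k (f a) := by
  have h := congr(pointsMap f B $(Points.mul_antipode (toConv (AlgHom.id k B))))
  rw [map_mul, map_one] at h
  exact congr(($(left_inv_eq_right_inv (Points.antipode_mul _) h)).ofConv a)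

theorem isHopfIdeal_comap {B : Type u} [CommRing B] [HopfAlgebra k B] (f : A →ₐc[k] B)
    (J : Ideal B) [J.IsHopfIdeal k] : (J.comap f).IsHopfIdeal k where
  counit_eq_zero x hx := by
    rw [← CoalgHomClass.counit_comp_apply f x]
    exact Submodule.IsCoideal.counit_eq_zero (I := J.restrictScalars k) hx
  map_mkQ_comul_eq_zero x hx := by
    refine map_mkQ_eq_zero_of_map_eq_zero
      ((J.restrictScalars k).mkQ ∘ₗ (f : A →ₐ[k] B).toLinearMap) ?_ ?_
    · ext y
      simp
    · rw [TensorProduct.map_comp, LinearMap.comp_apply]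
      have h := CoalgHomClass.map_comp_comul_apply f x
      refine Eq.trans ?_
        (Submodule.IsCoideal.map_mkQ_comul_eq_zero (I := J.restrictScalars k) hx)
      exact congr(TensorProduct.map _ _ $h)
  antipode_mem x hx := by
    rw [Ideal.mem_comap, bialgHom_antipode]
    exact Ideal.IsHopfIdeal.antipode_mem (R := k) hx

theorem ringKrullDim_quotient_eq_of_surjective {R S : Type*} [CommRing R] [CommRing S]
    {f : R →+* S} (hf : Function.Surjective f) {I : Ideal R} (hI : RingHom.ker f = I) :
    ringKrullDim (R ⧸ I) = ringKrullDim S := by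
  subst hI
  exact ringKrullDim_eq_of_ringEquiv (RingHom.quotientKerEquivOfSurjective hf)

/-- The image of a one parameter unipotent subgroup of a closed subgroup `H` of `G` is a one
parameter unipotent subgroup of `G`. -/
theorem IsOneParamUnipotent.map_of_surjective [CharZero k] {B : Type u} [CommRing B]
    [HopfAlgebra k B] {f : A →ₐc[k] B} (hf : Function.Surjective f) {S : Subgroup (Points k B k)}
    (hS : IsOneParamUnipotent S) : IsOneParamUnipotent (S.map (pointsMap f k)) := by
  have key : ∀ (J : Ideal B) (R : Type v) [CommRing R] [Algebra k R] (g : Points k A R),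
      (∀ x ∈ J.comap f, g.ofConv x = 0) →
        ∃ h : Points k B R, (∀ x ∈ J, h.ofConv x = 0) ∧ pointsMap f R h = g := by
    intro J R _ _ g hg
    have hker : ∀ x, f x = 0 → g.ofConv x = 0 := fun x hx ↦ hg x (by simp [Ideal.mem_comap, hx])
    let h : Points k B R := toConv ((f : A →ₐ[k] B).liftOfSurjective hf g.ofConv hker)
    have hh : pointsMap f R h = g := by
      apply WithConv.ext
      ext a
      rw [pointsMap_apply]
      exact AlgHom.liftOfSurjective_apply ..
    refine ⟨h, fun x hx ↦ ?_, hh⟩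
    obtain ⟨x, rfl⟩ := hf x
    rw [← pointsMap_apply, hh]
    exact hg x hx
  rw [isOneParamUnipotent_iff] at hS ⊢
  obtain ⟨J, hJ, hU, hd, hS⟩ := hS
  refine ⟨J.comap f, isHopfIdeal_comap f J, ?_, ?_, fun g ↦ ?_⟩
  · intro g hg a
    obtain ⟨h, hh, rfl⟩ := key J _ g hg
    simp_rw [pointsMap_pow_apply]
    exact hU h hh _
  · rwa [ringKrullDim_quotient_eq_of_surjective
      (f := (Ideal.Quotient.mk J).comp (f : A →ₐ[k] B).toRingHom)
      (Ideal.Quotient.mk_surjective.comp hf) (by ext; simp [RingHom.mem_ker, Ideal.Quotient.eq_zero_iff_mem])]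
  · constructor
    · rintro ⟨h, hh, rfl⟩ x hx
      exact (hS h).1 hh _ hx
    · intro hg
      obtain ⟨h, hh, rfl⟩ := key J _ g hg
      exact ⟨h, (hS h).2 hh, rfl⟩

end Unipotent

/-! ### One parameter subgroups and their infinitesimal generators -/

section OneParameter

open Coalgebra WithConv Polynomial

theorem polynomial_eq_of_eval_natCast_eq {F : Type*} [Field F] [CharZero F] {P Q : F[X]}
    (h : ∀ j : ℕ, P.eval (j : F) = Q.eval (j : F)) : P = Q := by
  refine Polynomial.eq_of_infinite_eval_eq P Q ((Set.infinite_range_of_injective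
    (Nat.cast_injective (R := F))).mono ?_)
  rintro _ ⟨j, rfl⟩
  exact h j

variable {k : Type v} {A : Type u} [Field k] [CommRing A] [HopfAlgebra k A]

/-- The algebra homomorphism `k[G] → k[t]` is the one parameter subgroup `t ↦ exp(tT)` with
infinitesimal generator `T`. -/
structure IsExponential (lam : A →ₐ[k] k[X]) (T : A →ₗ[k] A) : Prop where
  coeff_zero : ∀ a, (lam a).coeff 0 = counit (R := k) a
  map_apply : ∀ a, lam (T a) = derivative (lam a)
  comul_comp : comul ∘ₗ T = T.lTensor A ∘ₗ comul

/-- Unipotence is tested over the algebraic closure. Since the values at natural numbers lie in `k`,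
a `k`-linear retraction of the closure onto `k`, applied to the coefficients, yields a polynomial
over `k`. -/
theorem exists_polynomial_of_isUnipotent [CharZero k] (g : Points k A k)
    (hg : ∀ a : A, ∃ P : (AlgebraicClosure k)[X], ∀ j : ℕ,
      algebraMap k (AlgebraicClosure k) ((g ^ j).ofConv a) = P.eval (j : AlgebraicClosure k)) (a : A) :
    ∃ P : k[X], ∀ j : ℕ, (g ^ j).ofConv a = P.eval (j : k) := by
  obtain ⟨P, hP⟩ := hg a
  obtain ⟨r, hr⟩ := (Algebra.linearMap k (AlgebraicClosure k)).exists_leftInverse_of_injective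
    (LinearMap.ker_eq_bot.2 (algebraMap k (AlgebraicClosure k)).injective)
  refine ⟨∑ i ∈ P.support, C (r (P.coeff i)) * X ^ i, fun j ↦ ?_⟩
  have h1 : r (algebraMap k (AlgebraicClosure k) ((g ^ j).ofConv a)) = (g ^ j).ofConv a :=
    congr($hr ((g ^ j).ofConv a))
  rw [← h1, hP, eval_eq_sum, sum_def, map_sum, eval_finsetSum]
  refine Finset.sum_congr rfl fun i _ ↦ ?_
  have : P.coeff i * (j : AlgebraicClosure k) ^ i = ((j : k) ^ i) • P.coeff i := by
    rw [Algebra.smul_def, map_pow, map_natCast, mul_comm]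
  rw [this, map_smul]
  rw [eval_mul, eval_C, eval_pow, eval_X, smul_eq_mul, mul_comm]

theorem exists_algHom_of_isUnipotent [CharZero k] (g : Points k A k)
    (hg : ∀ a : A, ∃ P : k[X], ∀ j : ℕ, (g ^ j).ofConv a = P.eval (j : k)) :
    ∃ lam : A →ₐ[k] k[X], ∀ a (j : ℕ), (g ^ j).ofConv a = (lam a).eval (j : k) := by
  choose P hP using hg
  refine ⟨AlgHom.ofLinearMap ⟨⟨P, fun a b ↦ ?_⟩, fun c a ↦ ?_⟩ ?_ fun a b ↦ ?_, hP⟩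
  all_goals refine polynomial_eq_of_eval_natCast_eq fun j ↦ ?_
  all_goals simp [← hP]

theorem isExponential_of_eval_eq [CharZero k] {g : Points k A k} {lam : A →ₐ[k] k[X]}
    (h : ∀ a (j : ℕ), (g ^ j).ofConv a = (lam a).eval (j : k)) :
    IsExponential lam (leftInvariantOp (lcoeff k 1 ∘ₗ lam.toLinearMap)) where
  coeff_zero a := by
    rw [coeff_zero_eq_eval_zero]
    simpa [Points.one_apply] using (h a 0).symm
  map_apply a := by
    refine polynomial_eq_of_eval_natCast_eq fun m ↦ ?_
    let r := ℛ k a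
    -- The group law `g^(m+j) = g^m g^j`, interpolated in `j`. Differentiating at `0` gives the
    -- derivative of `lam a` at `m`.
    have h1 : (lam a).comp (X + C (m : k)) =
        ∑ i ∈ r.index, C ((g ^ m).ofConv (r.left i)) * lam (r.right i) := by
      refine polynomial_eq_of_eval_natCast_eq fun j ↦ ?_
      have : (j : k) + m = ((m + j : ℕ) : k) := by push_cast; ring
      rw [eval_comp, eval_add, eval_X, eval_C, this, ← h, pow_add, Points.mul_apply _ _ r,
        eval_finsetSum]
      simp [h]
    have h2 := congr((derivative $h1).eval 0)
    rw [derivative_comp] at h2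
    simp only [derivative_add, derivative_X, derivative_C, add_zero, one_mul, eval_comp,
      eval_add, eval_X, eval_C, zero_add, derivative_sum, derivative_C_mul, eval_finsetSum,
      eval_mul] at h2
    rw [h2, ← h, leftInvariantOp_apply _ r, map_sum]
    refine Finset.sum_congr rfl fun i _ ↦ ?_
    rw [map_smul, smul_eq_mul, mul_comm, ← coeff_zero_eq_eval_zero, coeff_derivative]
    simp
  comul_comp := by
    ext a
    exact comul_leftInvariantOp _ a

theorem IsExponential.map_pow_apply {lam : A →ₐ[k] k[X]} {T : A →ₗ[k] A}
    (h : IsExponential lam T) (n : ℕ) (a : A) : lam ((T ^ n) a) = derivative^[n] (lam a) := by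
  induction n with
  | zero => rfl
  | succ n ih => rw [pow_succ', Module.End.mul_apply, h.map_apply, ih, Function.iterate_succ_apply']

theorem comul_comp_pow {T : A →ₗ[k] A} (hT : comul ∘ₗ T = T.lTensor A ∘ₗ comul) (n : ℕ) :
    comul ∘ₗ (T ^ n) = (T ^ n).lTensor A ∘ₗ comul := by
  induction n with
  | zero => exact congr($((LinearMap.lTensor_id A A).symm) ∘ₗ comul)
  | succ n ih =>
    rw [pow_succ, Module.End.mul_eq_comp, ← LinearMap.comp_assoc, ih, LinearMap.comp_assoc, hT,
      LinearMap.lTensor_comp, LinearMap.comp_assoc]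

theorem IsExponential.factorial_mul_coeff {lam : A →ₐ[k] k[X]} {T : A →ₗ[k] A}
    (h : IsExponential lam T) (n : ℕ) (a : A) :
    (n.factorial : k) * (lam a).coeff n = counit (R := k) ((T ^ n) a) := by
  rw [← h.coeff_zero, h.map_pow_apply, coeff_iterate_derivative]
  simp [Nat.descFactorial_self]

/-- The infinitesimal generator of a one parameter subgroup is locally nilpotent. -/
theorem IsExponential.exists_pow_eq_zero {lam : A →ₐ[k] k[X]} {T : A →ₗ[k] A}
    (h : IsExponential lam T) (a : A) : ∃ n, (T ^ n) a = 0 := by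
  let r := ℛ k a
  -- By left invariance `Tⁿ a` is a combination of the left legs of `Δ(a)`, with coefficients `n!`
  -- times the `n`-th coefficients of `lam` at the right legs; these vanish beyond the degrees.
  refine ⟨(r.index.sup fun i ↦ (lam (r.right i)).natDegree) + 1, ?_⟩
  rw [eq_leftInvariantOp (comul_comp_pow h.comul_comp _), leftInvariantOp_apply _ r]
  refine Finset.sum_eq_zero fun i hi ↦ ?_
  rw [LinearMap.comp_apply, ← h.factorial_mul_coeff, coeff_eq_zero_of_natDegree_lt, mul_zero, zero_smul]
  exact Nat.lt_succ_of_le (Finset.le_sup (f := fun i ↦ (lam (r.right i)).natDegree) hi)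

/-- One parameter subgroups with compatible infinitesimal generators are compatible. -/
theorem IsExponential.algHom_comp [CharZero k] {B : Type u} [CommRing B] [HopfAlgebra k B]
    {lam : A →ₐ[k] k[X]} {T : A →ₗ[k] A} (h : IsExponential lam T) {mu : B →ₐ[k] k[X]}
    {N : B →ₗ[k] B} (h' : IsExponential mu N) (φ : A →ₐc[k] B) (hφ : ∀ a, φ (T a) = N (φ a))
    (a : A) : mu (φ a) = lam a := by
  ext n
  have hn : (n.factorial : k) ≠ 0 := by exact_mod_cast n.factorial_ne_zero
  have hpow : φ ((T ^ n) a) = (N ^ n) (φ a) := by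
    induction n with
    | zero => rfl
    | succ n ih =>
      rw [pow_succ', pow_succ', Module.End.mul_apply, Module.End.mul_apply, hφ,
        ih (by exact_mod_cast n.factorial_ne_zero)]
  apply mul_left_cancel₀ hn
  rw [h.factorial_mul_coeff, h'.factorial_mul_coeff, ← hpow]
  exact CoalgHomClass.counit_comp_apply φ _

theorem aeval_add_eq_sum {R : Type*} [CommRing R] [Algebra k R] (s t : R) (P : k[X]) {m : ℕ}
    (hm : P.natDegree < m) :
    aeval (s + t) P = ∑ n ∈ Finset.range m, t ^ n * aeval s (hasseDeriv n P) := by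
  have h1 : aeval (s + t) P = (taylor s (P.map (algebraMap k R))).eval t := by
    rw [taylor_eval, aeval_def, eval₂_eq_eval_map, add_comm]
  rw [h1, eval_eq_sum_range' (n := m)]
  · refine Finset.sum_congr rfl fun n _ ↦ ?_
    rw [taylor_coeff, aeval_def, eval₂_eq_eval_map, mul_comm]
    congr 2
    ext i
    simp [hasseDeriv_coeff]
  · rw [natDegree_taylor]
    exact natDegree_map_le.trans_lt hm

theorem IsExponential.hasseDeriv_eq [CharZero k] {mu : A →ₐ[k] k[X]} {N : A →ₗ[k] A}
    (h : IsExponential mu N) (n : ℕ) {a : A} {κ : Type*} (r : Coalgebra.Repr k a κ) :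
    hasseDeriv n (mu a) = ∑ i ∈ r.index, (mu (r.right i)).coeff n • mu (r.left i) := by
  have hn : (n.factorial : k) ≠ 0 := by exact_mod_cast n.factorial_ne_zero
  have h1 : (n.factorial : k) • hasseDeriv n (mu a) = mu ((N ^ n) a) := by
    rw [h.map_pow_apply, ← factorial_smul_hasseDeriv, LinearMap.smul_apply, Nat.cast_smul_eq_nsmul]
  rw [← smul_right_inj hn, h1, eq_leftInvariantOp (comul_comp_pow h.comul_comp n),
    leftInvariantOp_apply _ r, map_sum, Finset.smul_sum]
  refine Finset.sum_congr rfl fun i _ ↦ ?_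
  rw [map_smul, LinearMap.comp_apply, ← h.factorial_mul_coeff, mul_smul]

/-- This is Taylor's formula: the `n`-th Hasse derivative of `mu a` is `mu (Nⁿ a) / n!`, which left
invariance expands along the comultiplication. Arbitrary `R` is needed in order to take `s` and `t`
generic. -/
theorem IsExponential.eval_add {R : Type*} [CommRing R] [Algebra k R] [CharZero k]
    {mu : A →ₐ[k] k[X]} {N : A →ₗ[k] A} (h : IsExponential mu N) (s t : R) :
    (toConv ((aeval (s + t)).comp mu) : Points k A R) =
      toConv ((aeval s).comp mu) * toConv ((aeval t).comp mu) := by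
  apply WithConv.ext
  ext a
  let r := ℛ k a
  -- Large enough to bound the degrees of `mu a` and of `mu` on all right legs, so that both
  -- expansions run over the same range.
  let m := (mu a).natDegree + (r.index.sup fun i ↦ (mu (r.right i)).natDegree) + 1
  rw [Points.mul_apply _ _ r]
  simp only [AlgHom.coe_comp, Function.comp_apply]
  rw [aeval_add_eq_sum s t _ (show (mu a).natDegree < m by lia)]
  simp_rw [h.hasseDeriv_eq _ r, map_sum, Finset.mul_sum]
  rw [Finset.sum_comm]
  refine Finset.sum_congr rfl fun i hi ↦ ?_
  have hi : (mu (r.right i)).natDegree < m := by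
    have := Finset.le_sup (f := fun i ↦ (mu (r.right i)).natDegree) hi
    lia
  rw [aeval_eq_sum_range' hi, Finset.mul_sum]
  refine Finset.sum_congr rfl fun n _ ↦ ?_
  rw [map_smul, mul_smul_comm, mul_smul_comm, mul_comm]

theorem IsExponential.pow_eq {R : Type*} [CommRing R] [Algebra k R] [CharZero k]
    {mu : A →ₐ[k] k[X]} {N : A →ₗ[k] A} (h : IsExponential mu N) (s : R) (j : ℕ) :
    (toConv ((aeval s).comp mu) : Points k A R) ^ j = toConv ((aeval (j * s)).comp mu) := by
  induction j with
  | zero =>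
    apply WithConv.ext
    ext a
    rw [pow_zero, Points.one_apply, ← h.coeff_zero]
    simp [aeval_def, eval₂_at_zero]
  | succ j ih => rw [pow_succ, ih, ← h.eval_add, Nat.cast_succ, add_mul, one_mul]

end OneParameter

/-! ### The closed subgroup traced out by a one parameter subgroup -/

section OneParameter

open Coalgebra WithConv Polynomial

variable {k : Type v} {A : Type u} [Field k] [CommRing A] [HopfAlgebra k A]
  {mu : A →ₐ[k] k[X]} {N : A →ₗ[k] A}

theorem IsExponential.isHopfIdeal_ker [CharZero k] (h : IsExponential mu N) :
    (RingHom.ker mu).IsHopfIdeal k where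
  counit_eq_zero x hx := by
    rw [← h.coeff_zero, (show mu x = 0 from hx), Polynomial.coeff_zero]
  map_mkQ_comul_eq_zero x hx := by
    refine map_mkQ_eq_zero_of_map_eq_zero mu.toLinearMap rfl ?_
    let i₁ : k[X] →ₐ[k] k[X] ⊗[k] k[X] := Algebra.TensorProduct.includeLeft
    let i₂ : k[X] →ₐ[k] k[X] ⊗[k] k[X] := Algebra.TensorProduct.includeRight
    -- At the generic parameters `X ⊗ 1` and `1 ⊗ X`, additivity expresses `(mu ⊗ mu)(Δ x)` through
    -- `mu x`, which is zero.
    have h1 := congr(($(h.eval_add (i₁ X) (i₂ X))).ofConv x)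
    rw [Points.mul_apply _ _ (ℛ k x)] at h1
    have hi₁ : aeval (i₁ X) = i₁ := by ext; simp
    have hi₂ : aeval (i₂ X) = i₂ := by ext; simp
    simp only [hi₁, hi₂, AlgHom.comp_apply, (show mu x = 0 from hx), map_zero] at h1
    rw [← (ℛ k x).eq, map_sum, h1]
    refine Finset.sum_congr rfl fun i _ ↦ ?_
    simp [i₁, i₂]
  antipode_mem x hx := by
    -- The inverse of the generic value of the one parameter subgroup is its value at `-X`, which
    -- also kills `ker mu`.
    have h1 : toConv ((aeval (-X)).comp mu) * (toConv ((aeval X).comp mu) : Points k A k[X]) = 1 := by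
      have h0 := h.pow_eq (0 : k[X]) 0
      rw [mul_zero, pow_zero] at h0
      rw [← h.eval_add, neg_add_cancel, h0]
    have h2 := congr(($(left_inv_eq_right_inv h1 (Points.mul_antipode _))).ofConv x)
    simp only [AlgHom.comp_apply, (show mu x = 0 from hx), map_zero, aeval_X_left] at h2
    exact h2.symm

/-- The dichotomy between a closed embedding of the additive group and the trivial homomorphism. If
some `mu a` is nonconstant, repeated application of `N` differentiates it down to degree one, so `X`
lies in the image. -/
theorem IsExponential.surjective_or_eq_C [CharZero k] (h : IsExponential mu N) :
    Function.Surjective mu ∨ ∀ a, mu a = C (counit (R := k) a) := by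
  by_cases hc : ∀ a, (mu a).natDegree = 0
  · right
    intro a
    rw [← h.coeff_zero]
    exact eq_C_of_natDegree_eq_zero (hc a)
  · left
    push Not at hc
    obtain ⟨a, ha⟩ := hc
    obtain ⟨n, hn⟩ := Nat.exists_eq_succ_of_ne_zero ha
    have hb := h.map_pow_apply n a
    set b := (N ^ n) a
    have h1 : (mu b).natDegree ≤ 1 := by
      rw [hb]
      refine (natDegree_iterate_derivative _ _).trans ?_
      lia
    have h2 : (mu b).coeff 1 ≠ 0 := by
      rw [hb, coeff_iterate_derivative, add_comm 1 n, ← Nat.succ_eq_add_one, ← hn, nsmul_eq_mul]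
      refine mul_ne_zero ?_ ?_
      · rw [Nat.cast_ne_zero, Ne, Nat.descFactorial_eq_zero_iff_lt]
        lia
      · rw [coeff_natDegree, Ne, leadingCoeff_eq_zero]
        rintro h0
        simp [h0] at ha
    have hX : X ∈ mu.range := by
      refine ⟨((mu b).coeff 1)⁻¹ • (b - algebraMap k A ((mu b).coeff 0)), ?_⟩
      have h3 := eq_X_add_C_of_natDegree_le_one h1
      have h4 : mu b - C ((mu b).coeff 0) = (mu b).coeff 1 • X := by
        rw [smul_eq_C_mul, sub_eq_iff_eq_add]
        exact h3
      change mu _ = _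
      rw [map_smul, map_sub, mu.commutes]
      change _ • (mu b - C _) = _
      rw [h4, inv_smul_smul₀ h2]
    have : mu.range = ⊤ := by
      rw [eq_top_iff, ← adjoin_X, Algebra.adjoin_le_iff]
      simpa using hX
    exact AlgHom.range_eq_top mu |>.1 this

theorem IsExponential.exists_eq_eval [CharZero k] (h : IsExponential mu N) {R : Type*} [CommRing R]
    [Algebra k R] (g : Points k A R) (hg : ∀ x ∈ RingHom.ker mu, g.ofConv x = 0) :
    ∃ τ : R, g = toConv ((aeval τ).comp mu) := by
  rcases h.surjective_or_eq_C with hs | hc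
  · let e : k[X] →ₐ[k] R := mu.liftOfSurjective hs g.ofConv hg
    have he : aeval (e X) = e := by ext; simp
    refine ⟨e X, ?_⟩
    apply WithConv.ext
    ext a
    rw [he]
    exact (AlgHom.liftOfSurjective_apply mu hs g.ofConv hg a).symm
  · refine ⟨0, ?_⟩
    apply WithConv.ext
    ext a
    have h1 := hg (a - algebraMap k A (counit a)) (by
      rw [RingHom.mem_ker, map_sub, hc]
      change _ - mu _ = 0
      rw [mu.commutes]
      exact sub_self _)
    rw [map_sub, sub_eq_zero, AlgHom.commutes] at h1
    rw [h1]
    simp [hc]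

theorem IsExponential.ringKrullDim_le [CharZero k] (h : IsExponential mu N) :
    ringKrullDim (A ⧸ RingHom.ker mu) ≤ 1 := by
  rcases h.surjective_or_eq_C with hs | hc
  · rw [ringKrullDim_quotient_eq_of_surjective (f := (mu : A →+* k[X])) (I := RingHom.ker mu) hs rfl,
      ringKrullDim_of_isNoetherianRing, ringKrullDim_eq_zero_of_field, zero_add]
  · rw [ringKrullDim_quotient_eq_of_surjective (f := (Bialgebra.counitAlgHom k A : A →+* k)),
      ringKrullDim_eq_zero_of_field]
    · exact zero_le_one
    · exact fun c ↦ ⟨algebraMap k A c, by simp⟩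
    · ext a
      simp [RingHom.mem_ker, hc]

/-- The values of a one parameter subgroup form a one parameter algebraic unipotent subgroup. -/
theorem IsExponential.exists_isOneParamUnipotent [CharZero k] (h : IsExponential mu N) :
    ∃ S : Subgroup (Points k A k), IsOneParamUnipotent S ∧
      ∀ g, g ∈ S ↔ ∃ τ : k, g = toConv ((aeval τ).comp mu) := by
  have hI := h.isHopfIdeal_ker
  refine ⟨_, ⟨RingHom.ker mu, hI, ?_, h.ringKrullDim_le, rfl⟩, fun g ↦ ?_⟩
  · rw [isUnipotentGroup_quotient_iff]
    intro g hg a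
    obtain ⟨τ, rfl⟩ := h.exists_eq_eval g hg
    refine ⟨((mu a).map (algebraMap k _)).comp (X * C τ), fun j ↦ ?_⟩
    rw [h.pow_eq]
    rw [eval_comp, eval_map_algebraMap, eval_mul, eval_X, eval_C]
    rfl
  · refine (exists_pointsMap_mk_eq_iff (RingHom.ker mu) g).trans ⟨h.exists_eq_eval g, ?_⟩
    rintro ⟨τ, rfl⟩ x hx
    simp [(show mu x = 0 from hx)]

end OneParameter

/-! ### Exponentiating locally nilpotent derivations -/

section Exponential

open Coalgebra WithConv Polynomial

variable {k : Type v} {A : Type u} [Field k] [CommRing A] [HopfAlgebra k A]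

/-- Multiplication intertwines `N ⊗ 1 + 1 ⊗ N` with `N`, and the two summands commute, so the
binomial theorem applies. -/
theorem leibniz_pow_apply {N : A →ₗ[k] A} (hN : ∀ a b, N (a * b) = N a * b + a * N b) (n : ℕ)
    (a b : A) : (N ^ n) (a * b) =
      ∑ m ∈ Finset.HasAntidiagonal.antidiagonal n, n.choose m.1 • ((N ^ m.1) a * (N ^ m.2) b) := by
  let N₁ : Module.End k (A ⊗[k] A) := N.rTensor A
  let N₂ : Module.End k (A ⊗[k] A) := N.lTensor A
  have hc : Commute N₁ N₂ := by
    refine TensorProduct.ext' fun x y ↦ ?_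
    simp [N₁, N₂]
  have h₁ : ∀ i x y, (N₁ ^ i) (x ⊗ₜ y) = (N ^ i) x ⊗ₜ y := by
    intro i x y
    simp only [N₁]
    rw [LinearMap.rTensor_pow, LinearMap.rTensor_tmul]
  have h₂ : ∀ i x y, (N₂ ^ i) (x ⊗ₜ y) = x ⊗ₜ (N ^ i) y := by
    intro i x y
    simp only [N₂]
    rw [LinearMap.lTensor_pow, LinearMap.lTensor_tmul]
  have hmul : ∀ z, N (LinearMap.mul' k A z) = LinearMap.mul' k A ((N₁ + N₂) z) := by
    intro z
    induction z with
    | zero => simp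
    | add x y hx hy => simp only [map_add, hx, hy]
    | tmul x y => simp [N₁, N₂, hN]
  have hpow : ∀ z, (N ^ n) (LinearMap.mul' k A z) = LinearMap.mul' k A (((N₁ + N₂) ^ n) z) := by
    induction n with
    | zero => simp
    | succ n ih => intro z; rw [pow_succ, pow_succ, Module.End.mul_apply, Module.End.mul_apply, hmul, ih]
  have := hpow (a ⊗ₜ b)
  rw [hc.add_pow', LinearMap.mul'_apply] at this
  rw [this, LinearMap.sum_apply, map_sum]
  refine Finset.sum_congr rfl fun m _ ↦ ?_
  rw [LinearMap.smul_apply, map_nsmul, Module.End.mul_apply, h₂, h₁, LinearMap.mul'_apply]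

/-- A locally nilpotent left invariant derivation of `k[G]` generates a one parameter subgroup. -/
theorem exists_isExponential [CharZero k] {N : A →ₗ[k] A}
    (hN : ∀ a b, N (a * b) = N a * b + a * N b) (hcomul : comul ∘ₗ N = N.lTensor A ∘ₗ comul)
    (hnil : ∀ a, ∃ n, (N ^ n) a = 0) : ∃ mu : A →ₐ[k] k[X], IsExponential mu N := by
  choose m hm using hnil
  -- The Taylor series at the neutral element of `exp(tN) a`, truncated where `Nⁿ a` is already
  -- zero.
  let P : A → k[X] := fun a ↦ ∑ n ∈ Finset.range (m a),
    monomial n (counit (R := k) ((N ^ n) a) / (n.factorial : k))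
  have hP : ∀ a n, (P a).coeff n = counit (R := k) ((N ^ n) a) / (n.factorial : k) := by
    intro a n
    simp only [P, finsetSum_coeff, coeff_monomial]
    rw [Finset.sum_ite_eq']
    split_ifs with h
    · rfl
    · have h1 : (N ^ n) a = 0 := by
        rw [← Nat.sub_add_cancel (not_lt.1 (Finset.mem_range.not.1 h)), pow_add,
          Module.End.mul_apply, hm, map_zero]
      simp [h1]
  have hfac : ∀ n : ℕ, (n.factorial : k) ≠ 0 := fun n ↦ by exact_mod_cast n.factorial_ne_zero
  have hN1 : N 1 = 0 := by simpa using hN 1 1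
  refine ⟨AlgHom.ofLinearMap ⟨⟨P, fun a b ↦ ?_⟩, fun c a ↦ ?_⟩ ?_ fun a b ↦ ?_, ?_, ?_, hcomul⟩
  · ext n
    simp [hP, add_div]
  · ext n
    simp [hP, mul_div_assoc]
  · ext n
    change (P 1).coeff n = _
    rw [hP, coeff_one]
    rcases n with _ | n
    · simp
    · simp [pow_succ, hN1]
  · ext n
    change (P (a * b)).coeff n = (P a * P b).coeff n
    rw [hP, coeff_mul, leibniz_pow_apply hN, map_sum, Finset.sum_div]
    refine Finset.sum_congr rfl fun i hi ↦ ?_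
    rw [hP, hP, map_nsmul, Bialgebra.counit_mul, nsmul_eq_mul]
    have := Nat.add_choose_mul_factorial_mul_factorial i.2 i.1
    rw [add_comm, Finset.HasAntidiagonal.mem_antidiagonal.1 hi] at this
    have h2 : ((n.choose i.1 : ℕ) : k) * (i.1.factorial : k) * (i.2.factorial : k) =
      (n.factorial : k) := by
      rw [mul_right_comm]
      exact_mod_cast this
    have := hfac n
    have := hfac i.1
    have := hfac i.2
    field_simp
    rw [← h2]
    ring
  · intro a
    change (P a).coeff 0 = _
    simp [hP]
  · intro a
    change P (N a) = derivative (P a)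
    ext n
    rw [hP, coeff_derivative, hP, pow_succ, Module.End.mul_apply, Nat.factorial_succ]
    have := hfac n
    have : (n : k) + 1 ≠ 0 := by exact_mod_cast n.succ_ne_zero
    push_cast
    field_simp

end Exponential

/-! ### Extending derivations, encoded as ring homomorphisms to dual numbers -/

section DerivationExtension

/-- Derivations extend along extensions of fields of characteristic zero. -/
theorem exists_derivation_extension_field {F L : Type*} [Field F] [Field L] [Algebra F L] [CharZero F]
    (σ : F →+* TrivSqZeroExt L L) (hσ : ∀ x, (σ x).fst = algebraMap F L x) :
    ∃ s : L →+* TrivSqZeroExt L L, (∀ y, (s y).fst = y) ∧ ∀ x, s (algebraMap F L x) = σ x := by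
  -- In characteristic zero, `L` is separable algebraic over a purely transcendental extension of
  -- `F`. Formal smoothness then lifts the identity of `L` through the square zero extension.
  have hsm : Algebra.FormallySmooth F L := by
    obtain ⟨t, ht⟩ := exists_isTranscendenceBasis F L
    have := ht.isAlgebraic_field
    exact Algebra.FormallySmooth.of_algebraicIndependent_of_isSeparable ht.1
  let : Algebra F (TrivSqZeroExt L L) := σ.toAlgebra
  let p : TrivSqZeroExt L L →ₐ[F] L :=
    { (TrivSqZeroExt.fstHom L L L).toRingHom with commutes' := hσ }
  have hp : Function.Surjective p := fun y ↦ ⟨TrivSqZeroExt.inl y, rfl⟩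
  have hker : IsNilpotent (RingHom.ker (p : TrivSqZeroExt L L →+* L)) :=
    ⟨2, TrivSqZeroExt.kerIdeal_sq L L⟩
  refine ⟨(Algebra.FormallySmooth.liftOfSurjective (AlgHom.id F L) p hp hker).toRingHom,
    fun y ↦ ?_, fun x ↦ ?_⟩
  · exact Algebra.FormallySmooth.liftOfSurjective_apply (AlgHom.id F L) p hp hker y
  · exact AlgHom.commutes _ x

theorem exists_derivation_extension {D L : Type*} [CommRing D] [Field L] [CharZero L] (q : D →+* L)
    (σ : D →+* TrivSqZeroExt L L) (hσ : ∀ x, (σ x).fst = q x) (hq : ∀ x, q x = 0 → σ x = 0) :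
    ∃ s : L →+* TrivSqZeroExt L L, (∀ y, (s y).fst = y) ∧ ∀ x, s (q x) = σ x := by
  have hprime : (RingHom.ker q).IsPrime := RingHom.ker_isPrime q
  let D' := D ⧸ RingHom.ker q
  let : Algebra D' L := (RingHom.kerLift q).toAlgebra
  have hinj : Function.Injective (algebraMap D' L) := RingHom.kerLift_injective q
  have : FaithfulSMul D' L := (faithfulSMul_iff_algebraMap_injective D' L).2 hinj
  let := FractionRing.liftAlgebra D' L
  have := FractionRing.isScalarTower_liftAlgebra D' L
  have : CharZero (FractionRing D') :=
    (algebraMap (FractionRing D') L).charZero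
  let σ' : D' →+* TrivSqZeroExt L L := Ideal.Quotient.lift (RingHom.ker q) σ hq
  have hσ' : ∀ x, (σ' x).fst = algebraMap D' L x := by
    intro x
    obtain ⟨x, rfl⟩ := Ideal.Quotient.mk_surjective x
    exact hσ x
  have hunit : ∀ y : nonZeroDivisors D', IsUnit (σ' y) := by
    intro y
    rw [TrivSqZeroExt.isUnit_iff_isUnit_fst, hσ', isUnit_iff_ne_zero]
    exact (map_ne_zero_iff _ hinj).2 (nonZeroDivisors.ne_zero y.2)
  let τ : FractionRing D' →+* TrivSqZeroExt L L := IsLocalization.lift hunit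
  have hτ : ∀ x, τ (algebraMap D' (FractionRing D') x) = σ' x := IsLocalization.lift_eq hunit
  obtain ⟨s, hs, hsτ⟩ := exists_derivation_extension_field τ (by
    have : (TrivSqZeroExt.fstHom L L L).toRingHom.comp τ = algebraMap (FractionRing D') L := by
      refine IsLocalization.ringHom_ext (nonZeroDivisors D') ?_
      refine RingHom.ext fun x ↦ ?_
      change (τ (algebraMap D' (FractionRing D') x)).fst = _
      rw [hτ, hσ', RingHom.comp_apply, ← IsScalarTower.algebraMap_apply]
    exact fun x ↦ congr($this x))
  refine ⟨s, hs, fun x ↦ ?_⟩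
  have := hsτ (algebraMap D' (FractionRing D') (Ideal.Quotient.mk _ x))
  rw [hτ, ← IsScalarTower.algebraMap_apply] at this
  exact this

end DerivationExtension

/-! ### Lifting tangent vectors along a quotient homomorphism -/

section LiftTangent

open Coalgebra WithConv Polynomial

variable {k : Type v} {D B : Type u} [Field k] [CommRing D] [HopfAlgebra k D] [CommRing B]
  [HopfAlgebra k B]

theorem IsExponential.eq_leftInvariantOp_coeff {lam : D →ₐ[k] k[X]} {T : D →ₗ[k] D}
    (h : IsExponential lam T) : T = leftInvariantOp (lcoeff k 1 ∘ₗ lam.toLinearMap) := by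
  rw [eq_leftInvariantOp h.comul_comp]
  congr 1
  ext d
  simpa using (h.factorial_mul_coeff 1 d).symm

/-- The representation of `Δ(ab)` obtained from representations of `Δ(a)` and `Δ(b)`. -/
@[simps]
def reprMul {a b : D} {κ κ' : Type*} (r : Coalgebra.Repr k a κ) (r' : Coalgebra.Repr k b κ') :
    Coalgebra.Repr k (a * b) (κ × κ') where
  index := r.index ×ˢ r'.index
  left i := r.left i.1 * r'.left i.2
  right i := r.right i.1 * r'.right i.2
  eq := by
    rw [Bialgebra.comul_mul, ← r.eq, ← r'.eq, Finset.sum_mul_sum, Finset.sum_product]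
    simp

/-- The left invariant operator given by a tangent vector at the neutral element is a
derivation. -/
theorem leftInvariantOp_mul {f : D →ₗ[k] k}
    (hf : ∀ a b, f (a * b) = f a * counit (R := k) b + counit (R := k) a * f b) (a b : D) :
    leftInvariantOp f (a * b) = leftInvariantOp f a * b + a * leftInvariantOp f b := by
  have h1 : ∀ x : D, x = ∑ i ∈ (ℛ k x).index, counit (R := k) ((ℛ k x).right i) • (ℛ k x).left i :=
    fun x ↦ (leftInvariantOp_apply counit (ℛ k x) ▸ congr($(leftInvariantOp_counit) x)).symm
  rw [leftInvariantOp_apply f (reprMul (ℛ k a) (ℛ k b)), leftInvariantOp_apply f (ℛ k a),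
    leftInvariantOp_apply f (ℛ k b)]
  conv_rhs => enter [1, 2]; rw [h1 b]
  conv_rhs => enter [2, 1]; rw [h1 a]
  rw [Finset.sum_mul_sum, Finset.sum_mul_sum, ← Finset.sum_add_distrib]
  simp_rw [← Finset.sum_add_distrib]
  refine (Finset.sum_product _ _ _).trans ?_
  refine Finset.sum_congr rfl fun i _ ↦ Finset.sum_congr rfl fun j _ ↦ ?_
  simp only [reprMul_left, reprMul_right]
  rw [hf, add_smul, smul_mul_smul_comm, smul_mul_smul_comm]

theorem IsExponential.leibniz {lam : D →ₐ[k] k[X]} {T : D →ₗ[k] D}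
    (h : IsExponential lam T) (a b : D) : T (a * b) = T a * b + a * T b := by
  rw [h.eq_leftInvariantOp_coeff]
  refine leftInvariantOp_mul (fun a b ↦ ?_) a b
  simp [mul_coeff_one, h.coeff_zero, add_comm]

/-- Minimal primes are stable under the infinitesimal generator of a one parameter subgroup. -/
theorem IsExponential.mem_of_mem_minimalPrimes {lam : D →ₐ[k] k[X]} {T : D →ₗ[k] D}
    (h : IsExponential lam T) {p : Ideal D} (hp : p ∈ minimalPrimes D) {x : D} (hx : x ∈ p) :
    T x ∈ p := by
  have hprime : p.IsPrime := hp.isPrime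
  -- The flow `d ↦ exp(XT) d`. The contraction of `p[X]` along it is a prime inside `p`, by constant
  -- coefficients, hence equals `p` by minimality; the coefficient of `X` is `T`.
  let σ : Points k D D[X] :=
    toConv (CAlgHom (R := k) (A := D)) * toConv ((mapAlgHom (Algebra.ofId k D)).comp lam)
  have hσ : ∀ d n, (σ.ofConv d).coeff n = leftInvariantOp (lcoeff k n ∘ₗ lam.toLinearMap) d := by
    intro d n
    rw [Points.mul_apply _ _ (ℛ k d), finsetSum_coeff, leftInvariantOp_apply _ (ℛ k d)]
    refine Finset.sum_congr rfl fun i _ ↦ ?_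
    simp [CAlgHom, Algebra.smul_def, mul_comm]
  have h0 : lcoeff k 0 ∘ₗ lam.toLinearMap = counit := by
    ext d
    simpa using h.coeff_zero d
  have hle : (p.map C).comap σ.ofConv ≤ p := by
    intro y hy
    have := (Ideal.mem_map_C_iff.1 hy) 0
    rwa [hσ, h0, leftInvariantOp_counit] at this
  have hpC : (p.map (C : D →+* D[X])).IsPrime := Ideal.isPrime_map_C_of_isPrime
  have hge := hp.2 ⟨Ideal.comap_isPrime σ.ofConv (p.map C), bot_le⟩ hle
  have := (Ideal.mem_map_C_iff.1 (hge hx)) 1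
  rwa [hσ, ← h.eq_leftInvariantOp_coeff] at this

theorem sum_antipode_mul_apply {T : D →ₗ[k] D} (hT : comul ∘ₗ T = T.lTensor D ∘ₗ comul) {d : D}
    {κ : Type*} (r : Coalgebra.Repr k d κ) :
    ∑ i ∈ r.index, HopfAlgebraStruct.antipode k (r.left i) * T (r.right i) =
      algebraMap k D (counit (T d)) := by
  have h := congr($(HopfAlgebra.mul_antipode_rTensor_comul (R := k) (A := D)) (T d))
  simp only [LinearMap.comp_apply] at h
  rw [show comul (T d) = T.lTensor D (comul d) from congr($hT d), ← r.eq] at h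
  simpa using h

/-- The tangent vector of a one parameter subgroup of a quotient group lifts. -/
theorem IsExponential.exists_tangent_lift [CharZero k] {lam : D →ₐ[k] k[X]} {T : D →ₗ[k] D}
    (h : IsExponential lam T) (φ : D →ₐc[k] B) (hφ : Function.Injective φ) :
    ∃ Y : B →ₗ[k] k, (∀ a b, Y (a * b) = Y a * counit (R := k) b + counit (R := k) a * Y b) ∧
      ∀ d, Y (φ d) = counit (R := k) (T d) := by
  have : Nontrivial D := (Bialgebra.counitAlgHom k D).toRingHom.domain_nontrivial
  obtain ⟨p, hp⟩ : (minimalPrimes D).Nonempty := by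
    obtain ⟨m, hm⟩ := Ideal.exists_maximal D
    obtain ⟨p, hp, -⟩ := Ideal.exists_minimalPrimes_le (I := ⊥) (J := m) bot_le
    exact ⟨p, hp⟩
  obtain ⟨P, hP, hPp⟩ := Ideal.exists_comap_eq_of_mem_minimalPrimes_of_injective
    (f := (φ : D →ₐ[k] B).toRingHom) hφ p hp
  -- `g` below is a generic point of a closed subscheme of `H` dominating the component of `Q` cut
  -- out by `p`. As `T` preserves `p`, it induces a derivation there, and this extends to `L`.
  let L := FractionRing (B ⧸ P)
  have : CharZero L := charZero_of_injective_algebraMap (algebraMap k L).injective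
  let g : B →ₐ[k] L := (IsScalarTower.toAlgHom k (B ⧸ P) L).comp (Ideal.Quotient.mkₐ k P)
  have hg : ∀ b, g b = 0 ↔ b ∈ P := by
    intro b
    rw [← Ideal.Quotient.eq_zero_iff_mem]
    exact map_eq_zero_iff _ (IsFractionRing.injective (B ⧸ P) L)
  have hgφ : ∀ d, g (φ d) = 0 ↔ d ∈ p := by
    intro d
    rw [hg, ← hPp]
    rfl
  have hT1 : T 1 = 0 := by simpa using h.leibniz 1 1
  let σ : D →+* TrivSqZeroExt L L :=
    { toFun d := (g (φ d), g (φ (T d)))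
      map_one' := by
        refine TrivSqZeroExt.ext ?_ ?_
        · change g (φ 1) = 1
          simp
        · change g (φ (T 1)) = 0
          simp [hT1]
      map_zero' := by
        refine TrivSqZeroExt.ext ?_ ?_
        · change g (φ 0) = 0
          simp
        · change g (φ (T 0)) = 0
          simp
      map_add' a b := by
        refine TrivSqZeroExt.ext ?_ ?_
        · change g (φ (a + b)) = g (φ a) + g (φ b)
          simp
        · change g (φ (T (a + b))) = g (φ (T a)) + g (φ (T b))
          simp
      map_mul' a b := by
        refine TrivSqZeroExt.ext ?_ ?_
        · change g (φ (a * b)) = g (φ a) * g (φ b)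
          simp
        · change g (φ (T (a * b))) = g (φ a) * g (φ (T b)) + g (φ (T a)) * g (φ b)
          rw [h.leibniz]
          simp [add_comm] }
  obtain ⟨s, hs, hsσ⟩ := exists_derivation_extension (g.toRingHom.comp (φ : D →ₐ[k] B).toRingHom) σ
    (fun _ ↦ rfl) (fun d hd ↦ TrivSqZeroExt.ext hd
      ((hgφ _).2 (h.mem_of_mem_minimalPrimes hp ((hgφ d).1 hd))))
  have hsmul : ∀ a b, (s (g (a * b))).snd = g a * (s (g b)).snd + (s (g a)).snd * g b := by
    intro a b
    rw [map_mul, map_mul, TrivSqZeroExt.snd_mul, hs, hs]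
    simp
  have hsk : ∀ c, (s (g (algebraMap k B c))).snd = 0 := by
    intro c
    have h1 : g (algebraMap k B c) = g (φ (algebraMap k D c)) :=
      congrArg g ((φ : D →ₐ[k] B).commutes c).symm
    rw [h1]
    refine (congrArg TrivSqZeroExt.snd (hsσ (algebraMap k D c))).trans ?_
    change g (φ (T (algebraMap k D c))) = 0
    rw [Algebra.algebraMap_eq_smul_one, map_smul, hT1]
    simp
  let δ : B →ₗ[k] L :=
    { toFun b := (s (g b)).snd
      map_add' a b := by rw [map_add, RingHom.map_add, TrivSqZeroExt.snd_add]
      map_smul' c b := by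
        rw [Algebra.smul_def, hsmul, hsk, zero_mul, add_zero, Algebra.smul_def, AlgHom.commutes]
        rfl }
  -- `δ` is a tangent vector at `g ∈ H(L)`; convolution with the inverse of `g` translates it to the
  -- neutral element. Left invariance of `T` makes the result independent of `g` on `k[Q]`.
  let Z : WithConv (B →ₗ[k] L) :=
    toConv (g.comp (HopfAlgebra.antipodeAlgHom k B)).toLinearMap * toConv δ
  have hZ : ∀ {b : B} {κ : Type u} (r : Coalgebra.Repr k b κ), Z.ofConv b =
      ∑ i ∈ r.index, g (HopfAlgebraStruct.antipode k (r.left i)) * δ (r.right i) := by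
    intro b κ r
    exact r.convMul_apply _ _
  have hZmul : ∀ a b, Z.ofConv (a * b) =
      counit (R := k) b • Z.ofConv a + counit (R := k) a • Z.ofConv b := by
    have hanti : ∀ b : B, ∑ i ∈ (ℛ k b).index,
        g (HopfAlgebraStruct.antipode k ((ℛ k b).left i)) * g ((ℛ k b).right i) =
          algebraMap k L (counit b) := by
      intro b
      rw [← g.commutes, ← HopfAlgebra.sum_antipode_mul_eq_algebraMap_counit (ℛ k b), map_sum]
      simp
    intro a b
    rw [hZ (reprMul (ℛ k a) (ℛ k b)), hZ (ℛ k a), hZ (ℛ k b), Algebra.smul_def, Algebra.smul_def,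
      ← hanti, ← hanti, mul_comm (∑ i ∈ (ℛ k b).index, _), Finset.sum_mul_sum, Finset.sum_mul_sum,
      ← Finset.sum_add_distrib]
    simp_rw [← Finset.sum_add_distrib]
    refine (Finset.sum_product _ _ _).trans ?_
    refine Finset.sum_congr rfl fun i _ ↦ Finset.sum_congr rfl fun j _ ↦ ?_
    simp only [reprMul_left, reprMul_right]
    rw [show δ (_ * _) = _ from hsmul _ _, HopfAlgebra.antipode_mul_distrib, map_mul]
    change _ * (g _ * δ _ + δ _ * g _) = _
    ring
  have hZφ : ∀ d, Z.ofConv (φ d) = algebraMap k L (counit (T d)) := by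
    intro d
    have hδ : ∀ x, δ (φ x) = g (φ (T x)) := fun x ↦ congrArg TrivSqZeroExt.snd (hsσ x)
    have h1 := congrArg (fun x ↦ g (φ x)) (sum_antipode_mul_apply h.comul_comp (ℛ k d))
    have h2 : g (φ (algebraMap k D (counit (T d)))) = algebraMap k L (counit (T d)) := by
      rw [← g.commutes]
      exact congrArg g ((φ : D →ₐ[k] B).commutes _)
    rw [hZ ((ℛ k d).induced φ), ← h2, ← h1, map_sum, map_sum]
    refine Finset.sum_congr rfl fun i _ ↦ ?_
    change g (HopfAlgebraStruct.antipode k (φ _)) * δ (φ _) = _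
    rw [hδ, map_mul, map_mul, bialgHom_antipode]
  -- The tangent vector conditions at the neutral element are `k`-linear, so a `k`-linear retraction
  -- `L → k` preserves them.
  obtain ⟨r, hr⟩ := (Algebra.linearMap k L).exists_leftInverse_of_injective
    (LinearMap.ker_eq_bot.2 (algebraMap k L).injective)
  have hr : ∀ c, r (algebraMap k L c) = c := fun c ↦ congr($hr c)
  refine ⟨r ∘ₗ Z.ofConv, fun a b ↦ ?_, fun d ↦ ?_⟩
  · simp [hZmul, mul_comm]
  · rw [LinearMap.comp_apply, hZφ, hr]

end LiftTangent

/-! ### Additive Jordan decomposition of locally algebraic operators -/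

section Jordan

open Polynomial

variable {k : Type*} [Field k]

/-- The class of `s` is the semisimple part of the class of `X` in `k[X] / (g)`. -/
def IsSemisimplePartMod (s g : k[X]) : Prop :=
  (∃ p : k[X], Squarefree p ∧ g ∣ p.comp s) ∧ ∃ m, g ∣ (X - s) ^ m

theorem IsSemisimplePartMod.aeval {s g : k[X]} (h : IsSemisimplePartMod s g) {R : Type*}
    [CommRing R] [Algebra k R] {z : R} (hz : aeval z g = 0) :
    (∃ p : k[X], Squarefree p ∧ aeval (aeval z s) p = 0) ∧ IsNilpotent (z - aeval z s) := by
  obtain ⟨⟨p, hp, c, hc⟩, m, d, hd⟩ := h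
  refine ⟨⟨p, hp, ?_⟩, m, ?_⟩
  · rw [← aeval_comp, hc, map_mul, hz, zero_mul]
  · have := congr(Polynomial.aeval z $hd)
    rwa [map_mul, hz, zero_mul, map_pow, map_sub, aeval_X] at this

variable {V : Type*} [AddCommGroup V] [Module k V]

/-- An operator is locally algebraic if every vector is annihilated by a nonzero polynomial in it. -/
def IsLocallyAlgebraic (T : Module.End k V) : Prop :=
  ∀ v, ∃ g : k[X], g ≠ 0 ∧ aeval T g v = 0

theorem aeval_apply_eq_zero_of_dvd {T : Module.End k V} {g f : k[X]} (h : g ∣ f) {v : V}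
    (hv : aeval T g v = 0) : aeval T f v = 0 := by
  obtain ⟨c, rfl⟩ := h
  rw [mul_comm, map_mul, Module.End.mul_apply, hv, map_zero]

theorem map_aeval_apply {V' : Type*} [AddCommGroup V'] [Module k V'] {T : Module.End k V}
    {T' : Module.End k V'} {f : V →ₗ[k] V'} (h : ∀ v, f (T v) = T' (f v)) (p : k[X]) (v : V) :
    f (aeval T p v) = aeval T' p (f v) := by
  induction p using Polynomial.induction_on' generalizing v with
  | add p q hp hq => simp only [map_add, LinearMap.add_apply, hp, hq]
  | monomial n c =>
    rw [aeval_monomial, aeval_monomial, Module.End.mul_apply, Module.End.mul_apply,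
      Module.algebraMap_end_apply, Module.algebraMap_end_apply, map_smul]
    congr 1
    induction n with
    | zero => rfl
    | succ n ih => rw [pow_succ', pow_succ', Module.End.mul_apply, Module.End.mul_apply, h, ih]

theorem isLocallyAlgebraic_of_pow_eq_zero {T : Module.End k V} (h : ∀ v, ∃ n, (T ^ n) v = 0) :
    IsLocallyAlgebraic T := fun v ↦
  let ⟨n, hn⟩ := h v
  ⟨X ^ n, pow_ne_zero _ X_ne_zero, by simpa using hn⟩

variable [PerfectField k]

/-- Both elements are roots of one squarefree polynomial `P`, and `P'` is a unit at `x` because the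
field is perfect. A simple root is unique in its class modulo nilpotents. -/
theorem eq_of_isNilpotent_sub_of_squarefree {R : Type*} [CommRing R] [Algebra k R] {x y : R}
    (hxy : IsNilpotent (x - y)) {p q : k[X]} (hp : Squarefree p) (hq : Squarefree q)
    (hx : aeval x p = 0) (hy : aeval y q = 0) : x = y := by
  classical
  obtain ⟨P, n, hP, hPdvd, hdvdP⟩ :=
    exists_squarefree_dvd_pow_of_ne_zero (mul_ne_zero hp.ne_zero hq.ne_zero)
  have hroot : ∀ {z : R} {r : k[X]}, Squarefree r → r ∣ p * q → aeval z r = 0 → aeval z P = 0 := by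
    intro z r hr hrd hz
    obtain ⟨c, hc⟩ := (hr.isRadical n P (hrd.trans hdvdP) : r ∣ P)
    rw [hc, map_mul, hz, zero_mul]
  have hx' := hroot hp (dvd_mul_right p q) hx
  have hy' := hroot hq (dvd_mul_left q p) hy
  obtain ⟨a, b, hab⟩ := PerfectField.separable_iff_squarefree.2 hP
  have hunit : IsUnit (aeval x (derivative P)) := by
    refine .of_mul_eq_one_right (aeval x b) ?_
    have := congr(aeval x $hab)
    rwa [map_add, map_mul, map_mul, hx', mul_zero, zero_add, map_one] at this
  exact (existsUnique_nilpotent_sub_and_aeval_eq_zero (hx' ▸ IsNilpotent.zero) hunit).unique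
    ⟨by simp, hx'⟩ ⟨hxy, hy'⟩

theorem exists_squarefree_aeval_add_eq_zero {R : Type*} [CommRing R] [Algebra k R]
    [Module.Finite k R] {x y : R} {p q : k[X]} (hp : Squarefree p) (hq : Squarefree q)
    (hx : aeval x p = 0) (hy : aeval y q = 0) : ∃ r : k[X], Squarefree r ∧ aeval (x + y) r = 0 := by
  have hss : ∀ {z : R} {r : k[X]}, Squarefree r → aeval z r = 0 →
      (Algebra.lmul k R z).IsSemisimple := by
    intro z r hr hz
    refine Module.End.isSemisimple_of_squarefree_aeval_eq_zero hr ?_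
    rw [aeval_algHom_apply, hz, map_zero]
  have hadd : (Algebra.lmul k R (x + y)).IsSemisimple := by
    rw [map_add]
    exact Module.End.IsSemisimple.add_of_commute ((Commute.all x y).map (Algebra.lmul k R))
      (hss hp hx) (hss hq hy)
  refine ⟨_, hadd.minpoly_squarefree, Algebra.lmul_injective (R := k) ?_⟩
  rw [← aeval_algHom_apply, minpoly.aeval, map_zero]

/-- Newton iteration in `k[X]/(g)`: `X` is a root modulo nilpotents of the squarefree `P`, with
`P'(X)` a unit, and so is congruent to an exact root. -/
theorem exists_isSemisimplePartMod {g : k[X]} (hg : g ≠ 0) : ∃ s, IsSemisimplePartMod s g := by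
  obtain ⟨P, n, hP, -, hdvd⟩ := exists_squarefree_dvd_pow_of_ne_zero hg
  let R := k[X] ⧸ Ideal.span {g}
  let mk : k[X] →ₐ[k] R := Ideal.Quotient.mkₐ k (Ideal.span {g})
  have hmk : ∀ f, mk f = 0 ↔ g ∣ f := fun f ↦
    Ideal.Quotient.eq_zero_iff_mem.trans Ideal.mem_span_singleton
  have hnil : IsNilpotent (aeval (mk X) P) := by
    refine ⟨n, ?_⟩
    rw [aeval_algHom_apply, aeval_X_left_apply, ← map_pow, hmk]
    exact hdvd
  have hunit : IsUnit (aeval (mk X) (derivative P)) := by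
    obtain ⟨a, b, hab⟩ : IsCoprime (P ^ n) (derivative P) :=
      (PerfectField.separable_iff_squarefree.2 hP).pow_left
    refine .of_mul_eq_one_right (aeval (mk X) b) ?_
    have h1 := congr(mk $hab)
    rw [map_add, map_mul, map_mul, (hmk _).2 hdvd, mul_zero, zero_add, map_one] at h1
    rwa [aeval_algHom_apply, aeval_X_left_apply, aeval_algHom_apply, aeval_X_left_apply]
  obtain ⟨r, ⟨⟨m, hm⟩, hr⟩, -⟩ := existsUnique_nilpotent_sub_and_aeval_eq_zero hnil hunit
  obtain ⟨s, rfl⟩ := Ideal.Quotient.mk_surjective r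
  refine ⟨s, ⟨P, hP, ?_⟩, m, ?_⟩
  · rw [← hmk, ← hr, comp_eq_aeval, ← aeval_algHom_apply]
    rfl
  · rw [← hmk, ← hm, map_pow, map_sub]
    rfl

theorem IsSemisimplePartMod.aeval_eq {s s' g g' : k[X]} (h : IsSemisimplePartMod s g)
    (h' : IsSemisimplePartMod s' g') {R : Type*} [CommRing R] [Algebra k R] {z : R}
    (hz : Polynomial.aeval z g = 0) (hz' : Polynomial.aeval z g' = 0) :
    Polynomial.aeval z s = Polynomial.aeval z s' := by
  obtain ⟨⟨p, hp, hpz⟩, hn⟩ := h.aeval hz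
  obtain ⟨⟨q, hq, hqz⟩, hn'⟩ := h'.aeval hz'
  refine eq_of_isNilpotent_sub_of_squarefree ?_ hp hq hpz hqz
  rw [← sub_sub_sub_cancel_left _ _ z]
  exact (Commute.all _ _).isNilpotent_sub hn' hn

theorem IsSemisimplePartMod.aeval_apply_eq {s s' g g' : k[X]} (h : IsSemisimplePartMod s g)
    (h' : IsSemisimplePartMod s' g') {T : Module.End k V} {v : V}
    (hv : Polynomial.aeval T g v = 0) (hv' : Polynomial.aeval T g' v = 0) :
    Polynomial.aeval T s v = Polynomial.aeval T s' v := by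
  -- Both polynomials annihilate `v`, so the comparison can be made in the commutative ring
  -- `k[X]/(g, g')`.
  let I : Ideal k[X] := Ideal.span {g, g'}
  have hI : ∀ f ∈ I, Polynomial.aeval T f v = 0 := by
    intro f hf
    obtain ⟨a, b, rfl⟩ := Ideal.mem_span_pair.1 hf
    rw [map_add, LinearMap.add_apply, aeval_apply_eq_zero_of_dvd (dvd_mul_left g a) hv,
      aeval_apply_eq_zero_of_dvd (dvd_mul_left g' b) hv', add_zero]
  have hz : ∀ f : k[X], Polynomial.aeval (Ideal.Quotient.mkₐ k I X) f = Ideal.Quotient.mk I f := by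
    intro f
    rw [aeval_algHom_apply, aeval_X_left_apply]
    rfl
  have := h.aeval_eq h' (z := Ideal.Quotient.mkₐ k I X)
    (by rw [hz, Ideal.Quotient.eq_zero_iff_mem]; exact Ideal.subset_span (by simp))
    (by rw [hz, Ideal.Quotient.eq_zero_iff_mem]; exact Ideal.subset_span (by simp))
  rw [hz, hz, Ideal.Quotient.mk_eq_mk_iff_sub_mem] at this
  have := hI _ this
  rwa [map_sub, LinearMap.sub_apply, sub_eq_zero] at this

/-- The semisimple part of a locally algebraic operator. -/
theorem IsLocallyAlgebraic.exists_semisimplePart {T : Module.End k V} (hT : IsLocallyAlgebraic T) :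
    ∃ S : Module.End k V, ∀ (s g : k[X]) (v : V), IsSemisimplePartMod s g → aeval T g v = 0 →
      S v = aeval T s v := by
  choose g hg hgv using hT
  choose s hs using fun v ↦ exists_isSemisimplePartMod (hg v)
  have key : ∀ (s' g' : k[X]) (v : V), IsSemisimplePartMod s' g' → aeval T g' v = 0 →
      aeval T (s v) v = aeval T s' v := fun s' g' v h h' ↦ (hs v).aeval_apply_eq h (hgv v) h'
  refine ⟨⟨⟨fun v ↦ aeval T (s v) v, fun v w ↦ ?_⟩, fun c v ↦ ?_⟩, key⟩
  · obtain ⟨s', hs'⟩ := exists_isSemisimplePartMod (mul_ne_zero (hg v) (hg w))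
    have hv := aeval_apply_eq_zero_of_dvd (dvd_mul_right (g v) (g w)) (hgv v)
    have hw := aeval_apply_eq_zero_of_dvd (dvd_mul_left (g w) (g v)) (hgv w)
    rw [key s' _ v hs' hv, key s' _ w hs' hw, ← map_add]
    exact key s' _ _ hs' (by rw [map_add, hv, hw, add_zero])
  · rw [RingHom.id_apply, ← map_smul]
    exact key (s v) _ _ (hs v) (by rw [map_smul, hgv, smul_zero])

/-- The semisimple part of a locally algebraic operator. -/
noncomputable def IsLocallyAlgebraic.semisimplePart {T : Module.End k V}
    (hT : IsLocallyAlgebraic T) : Module.End k V :=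
  hT.exists_semisimplePart.choose

theorem IsLocallyAlgebraic.semisimplePart_apply {T : Module.End k V} (hT : IsLocallyAlgebraic T)
    {s g : k[X]} {v : V} (h : IsSemisimplePartMod s g) (hv : aeval T g v = 0) :
    hT.semisimplePart v = aeval T s v :=
  hT.exists_semisimplePart.choose_spec s g v h hv

theorem IsLocallyAlgebraic.exists_sub_pow_apply_eq_zero {T : Module.End k V}
    (hT : IsLocallyAlgebraic T) (v : V) : ∃ m, ((T - hT.semisimplePart) ^ m) v = 0 := by
  obtain ⟨g, hg, hgv⟩ := hT v
  obtain ⟨s, hs⟩ := exists_isSemisimplePartMod hg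
  have key : ∀ j, ((T - hT.semisimplePart) ^ j) v = aeval T ((X - s) ^ j) v := by
    intro j
    induction j with
    | zero => simp
    | succ j ih =>
      have h0 : aeval T g (aeval T ((X - s) ^ j) v) = 0 := by
        rw [← Module.End.mul_apply, ← map_mul]
        exact aeval_apply_eq_zero_of_dvd (dvd_mul_right _ _) hgv
      rw [pow_succ', Module.End.mul_apply, ih, LinearMap.sub_apply,
        hT.semisimplePart_apply hs h0, pow_succ', map_mul, Module.End.mul_apply, map_sub,
        LinearMap.sub_apply, aeval_X]
  obtain ⟨m, hm⟩ := hs.2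
  exact ⟨m, by rw [key, aeval_apply_eq_zero_of_dvd hm hgv]⟩

theorem IsLocallyAlgebraic.map_semisimplePart {V' : Type*} [AddCommGroup V'] [Module k V']
    {T : Module.End k V} (hT : IsLocallyAlgebraic T) {T' : Module.End k V'}
    (hT' : IsLocallyAlgebraic T') {f : V →ₗ[k] V'} (h : ∀ v, f (T v) = T' (f v)) (v : V) :
    f (hT.semisimplePart v) = hT'.semisimplePart (f v) := by
  obtain ⟨g, hg, hgv⟩ := hT v
  obtain ⟨s, hs⟩ := exists_isSemisimplePartMod hg
  rw [hT.semisimplePart_apply hs hgv, map_aeval_apply h,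
    hT'.semisimplePart_apply hs (by rw [← map_aeval_apply h, hgv, map_zero])]

theorem IsLocallyAlgebraic.semisimplePart_eq_zero {T : Module.End k V}
    (hT : IsLocallyAlgebraic T) (h : ∀ v, ∃ n, (T ^ n) v = 0) : hT.semisimplePart = 0 := by
  ext v
  obtain ⟨n, hn⟩ := h v
  rw [hT.semisimplePart_apply (s := 0) (g := X ^ n) ⟨⟨X, irreducible_X.squarefree, by simp⟩, n, by simp⟩
    (by simpa using hn)]
  simp

/-- The semisimple part of a locally algebraic derivation is a derivation. -/
theorem IsLocallyAlgebraic.semisimplePart_mul {B : Type*} [CommRing B] [Algebra k B]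
    {T : Module.End k B} (hT : IsLocallyAlgebraic T) (hmul : ∀ a b, T (a * b) = T a * b + a * T b)
    (a b : B) :
    hT.semisimplePart (a * b) = hT.semisimplePart a * b + a * hT.semisimplePart b := by
  obtain ⟨g₁, hg₁, hga⟩ := hT a
  obtain ⟨g₂, hg₂, hgb⟩ := hT b
  let g := g₁ * g₂
  have hg : g ≠ 0 := mul_ne_zero hg₁ hg₂
  replace hga : aeval T g a = 0 := aeval_apply_eq_zero_of_dvd (dvd_mul_right _ _) hga
  replace hgb : aeval T g b = 0 := aeval_apply_eq_zero_of_dvd (dvd_mul_left _ _) hgb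
  obtain ⟨s, hs⟩ := exists_isSemisimplePartMod hg
  let Q := AdjoinRoot g
  have : Module.Finite k Q := (AdjoinRoot.powerBasis hg).finite
  let R := Q ⊗[k] Q
  let x : Q := AdjoinRoot.root g
  have hx : aeval x g = 0 := (AdjoinRoot.aeval_eq g).trans AdjoinRoot.mk_self
  have hxs : ∀ f, aeval x f = AdjoinRoot.mk g f := AdjoinRoot.aeval_eq
  have hev : ∀ c : B, aeval T g c = 0 → ∃ e : Q →ₗ[k] B, ∀ f, e (AdjoinRoot.mk g f) = aeval T f c := by
    intro c hc
    refine ⟨((Ideal.span {g}).restrictScalars k).liftQ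
      ((LinearMap.applyₗ c) ∘ₗ (aeval T).toLinearMap) ?_, fun f ↦ rfl⟩
    intro f hf
    exact aeval_apply_eq_zero_of_dvd (Ideal.mem_span_singleton.1 hf) hc
  obtain ⟨ea, hea⟩ := hev a hga
  obtain ⟨eb, heb⟩ := hev b hgb
  -- `ψ` sends `f ⊗ f'` to `f(T)a · f'(T)b`. By the Leibniz rule, multiplication by `z` becomes `T`,
  -- so the claim reduces to finding the semisimple part of `z`.
  let ψ : R →ₗ[k] B := LinearMap.mul' k B ∘ₗ TensorProduct.map ea eb
  let z : R := x ⊗ₜ 1 + 1 ⊗ₜ x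
  have hψt : ∀ y y' : Q, ψ (y ⊗ₜ y') = ea y * eb y' := fun _ _ ↦ rfl
  have hea1 : ea 1 = a := by simpa using hea 1
  have heb1 : eb 1 = b := by simpa using heb 1
  have hψ : ∀ r : R, ψ (Algebra.lmul k R z r) = T (ψ r) := by
    intro r
    induction r using TensorProduct.induction_on with
    | zero => simp
    | add r r' hr hr' => simp only [map_add, hr, hr']
    | tmul y y' =>
      obtain ⟨y, rfl⟩ := AdjoinRoot.mk_surjective y
      obtain ⟨y', rfl⟩ := AdjoinRoot.mk_surjective y'
      have hX : ∀ (e : Q →ₗ[k] B) c, (∀ f, e (AdjoinRoot.mk g f) = aeval T f c) → ∀ f,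
          e (x * AdjoinRoot.mk g f) = T (aeval T f c) := by
        intro e c he f
        rw [show x = AdjoinRoot.mk g X from rfl, ← map_mul, he, map_mul, aeval_X,
          Module.End.mul_apply]
      have hz : Algebra.lmul k R z (AdjoinRoot.mk g y ⊗ₜ AdjoinRoot.mk g y') =
          (x * AdjoinRoot.mk g y) ⊗ₜ AdjoinRoot.mk g y' +
            AdjoinRoot.mk g y ⊗ₜ (x * AdjoinRoot.mk g y') := by
        change (x ⊗ₜ[k] (1 : Q) + (1 : Q) ⊗ₜ[k] x) * (_ ⊗ₜ[k] _) = _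
        rw [add_mul, Algebra.TensorProduct.tmul_mul_tmul, Algebra.TensorProduct.tmul_mul_tmul,
          one_mul, one_mul]
      rw [hz, map_add, hψt, hψt, hψt, hX ea a hea, hX eb b heb, hea, heb, hmul]
  have hψp : ∀ f : k[X], ψ (aeval z f) = aeval T f (a * b) := by
    intro f
    have h1 := map_aeval_apply hψ f 1
    rw [aeval_algHom_apply] at h1
    have h2 : ψ 1 = a * b := by
      rw [Algebra.TensorProduct.one_def, hψt, hea1, heb1]
    rw [h2] at h1
    simpa using h1
  obtain ⟨⟨p, hp, hpx⟩, hnil⟩ := hs.aeval hx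
  let i₁ : Q →ₐ[k] R := Algebra.TensorProduct.includeLeft
  let i₂ : Q →ₐ[k] R := Algebra.TensorProduct.includeRight
  obtain ⟨q, hq, hqσ⟩ := exists_squarefree_aeval_add_eq_zero hp hp
    (show aeval (i₁ (aeval x s)) p = 0 by rw [aeval_algHom_apply, hpx, map_zero])
    (show aeval (i₂ (aeval x s)) p = 0 by rw [aeval_algHom_apply, hpx, map_zero])
  have hnilσ : IsNilpotent (z - (i₁ (aeval x s) + i₂ (aeval x s))) := by
    have : z - (i₁ (aeval x s) + i₂ (aeval x s)) = i₁ (x - aeval x s) + i₂ (x - aeval x s) := by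
      rw [map_sub, map_sub, sub_add_sub_comm]
      rfl
    rw [this]
    exact (Commute.all _ _).isNilpotent_add (hnil.map i₁) (hnil.map i₂)
  have hG : minpoly k z ≠ 0 := minpoly.ne_zero (Algebra.IsIntegral.isIntegral z)
  obtain ⟨s', hs'⟩ := exists_isSemisimplePartMod hG
  obtain ⟨⟨p', hp', hpz⟩, hnil'⟩ := hs'.aeval (minpoly.aeval k z)
  -- By uniqueness the semisimple part of `x ⊗ 1 + 1 ⊗ x` is the sum of those of the two terms, as a
  -- sum of commuting semisimple elements is semisimple.
  have hσ : aeval z s' = i₁ (aeval x s) + i₂ (aeval x s) := by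
    refine eq_of_isNilpotent_sub_of_squarefree ?_ hp' hq hpz hqσ
    rw [← sub_sub_sub_cancel_left _ _ z]
    exact (Commute.all _ _).isNilpotent_sub hnilσ hnil'
  rw [hT.semisimplePart_apply hs' (by rw [← hψp, minpoly.aeval, map_zero]), ← hψp, hσ, map_add,
    hT.semisimplePart_apply hs hga, hT.semisimplePart_apply hs hgb, hxs]
  rw [show ψ (i₁ (AdjoinRoot.mk g s)) = _ from hψt _ _,
    show ψ (i₂ (AdjoinRoot.mk g s)) = _ from hψt _ _, hea, heb, hea1, heb1]

end Jordan

/-! ### Lifting one parameter unipotent subgroups -/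

section Lift

open Coalgebra WithConv Polynomial

variable {k : Type v} {D B : Type u} [Field k] [CommRing D] [HopfAlgebra k D] [CommRing B]
  [HopfAlgebra k B]

/-- All `Tⁿ b` lie in the finite dimensional span of the left legs of `Δ(b)`, whereas `k[X]` is
infinite dimensional. -/
theorem isLocallyAlgebraic_of_comul_comp {T : Module.End k B}
    (hT : comul ∘ₗ T = T.lTensor B ∘ₗ comul) : IsLocallyAlgebraic T := by
  intro b
  let r := ℛ k b
  let W : Submodule k B := Submodule.span k (r.left '' r.index)
  have hW : ∀ n, (T ^ n) b ∈ W := by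
    intro n
    rw [eq_leftInvariantOp (comul_comp_pow hT n), leftInvariantOp_apply _ r]
    exact Submodule.sum_mem _ fun i hi ↦
      Submodule.smul_mem _ _ (Submodule.subset_span ⟨i, hi, rfl⟩)
  let f : k[X] →ₗ[k] B := LinearMap.applyₗ b ∘ₗ (aeval T).toLinearMap
  have hf : ∀ g, f g ∈ W := by
    intro g
    change aeval T g b ∈ W
    rw [aeval_eq_sum_range, LinearMap.sum_apply]
    exact Submodule.sum_mem _ fun n _ ↦ Submodule.smul_mem _ _ (hW n)
  have : Module.Finite k W := Module.Finite.span_of_finite k (r.index.finite_toSet.image _)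
  by_contra! h
  refine Polynomial.not_finite (R := k) (Module.Finite.of_injective (f.codRestrict W hf) ?_)
  rw [← LinearMap.ker_eq_bot, LinearMap.ker_codRestrict, LinearMap.ker_eq_bot']
  exact fun g hg ↦ by_contra fun h0 ↦ h g h0 hg

theorem IsLocallyAlgebraic.lTensor {V : Type*} [AddCommGroup V] [Module k V] {T : Module.End k V}
    (hT : IsLocallyAlgebraic T) (U : Type*) [AddCommGroup U] [Module k U] :
    IsLocallyAlgebraic (V := U ⊗[k] V) (T.lTensor U) := by
  intro z
  induction z with
  | zero => exact ⟨1, one_ne_zero, map_zero _⟩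
  | add z z' hz hz' =>
    obtain ⟨g, hg, hgz⟩ := hz
    obtain ⟨g', hg', hgz'⟩ := hz'
    refine ⟨g * g', mul_ne_zero hg hg', ?_⟩
    rw [map_add, aeval_apply_eq_zero_of_dvd (dvd_mul_right g g') hgz,
      aeval_apply_eq_zero_of_dvd (dvd_mul_left g' g) hgz', add_zero]
  | tmul w v =>
    obtain ⟨g, hg, hgv⟩ := hT v
    refine ⟨g, hg, ?_⟩
    have := map_aeval_apply (T := T) (T' := T.lTensor U) (f := TensorProduct.mk k U V w)
      (fun _ ↦ rfl) g v
    rw [hgv, map_zero] at this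
    exact this.symm

/-- The semisimple part of a left invariant operator is left invariant. -/
theorem comul_comp_semisimplePart [PerfectField k] {T : Module.End k B}
    (hT : comul ∘ₗ T = T.lTensor B ∘ₗ comul) (hT' : IsLocallyAlgebraic T) :
    comul ∘ₗ hT'.semisimplePart = (hT'.semisimplePart).lTensor B ∘ₗ comul := by
  have h1 : ∀ z, hT'.semisimplePart.lTensor B z = (hT'.lTensor B).semisimplePart z := by
    intro z
    induction z with
    | zero => simp
    | add z z' hz hz' => rw [map_add, map_add, hz, hz']
    | tmul w v =>
      exact hT'.map_semisimplePart (hT'.lTensor B) (f := TensorProduct.mk k B B w) (fun _ ↦ rfl) v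
  ext b
  rw [LinearMap.comp_apply, LinearMap.comp_apply, h1]
  exact hT'.map_semisimplePart (hT'.lTensor B) (f := comul) (fun v ↦ congr($hT v)) b

/-- One parameter unipotent subgroups lift along quotient homomorphisms. -/
theorem IsExponential.exists_lift [CharZero k] {lam : D →ₐ[k] k[X]} {T : D →ₗ[k] D}
    (h : IsExponential lam T) (φ : D →ₐc[k] B) (hφ : Function.Injective φ) :
    ∃ (mu : B →ₐ[k] k[X]) (N : B →ₗ[k] B), IsExponential mu N ∧ ∀ d, mu (φ d) = lam d := by
  obtain ⟨Y, hY, hYφ⟩ := h.exists_tangent_lift φ hφ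
  let M : Module.End k B := leftInvariantOp Y
  have hMφ : ∀ d, φ (T d) = M (φ d) := by
    intro d
    have : Y ∘ₗ (φ : D →ₐ[k] B).toLinearMap = counit ∘ₗ T := LinearMap.ext hYφ
    rw [← bialgHom_leftInvariantOp φ Y d, this, ← eq_leftInvariantOp h.comul_comp]
  have hMmul : ∀ a b, M (a * b) = M a * b + a * M b := leftInvariantOp_mul hY
  have hMcomul : comul ∘ₗ M = M.lTensor B ∘ₗ comul := LinearMap.ext (comul_leftInvariantOp Y)
  have hM : IsLocallyAlgebraic M := isLocallyAlgebraic_of_comul_comp hMcomul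
  have hT : IsLocallyAlgebraic T := isLocallyAlgebraic_of_pow_eq_zero h.exists_pow_eq_zero
  obtain ⟨mu, hmu⟩ := exists_isExponential (N := M - hM.semisimplePart)
    (fun a b ↦ by
      simp only [LinearMap.sub_apply, hMmul, hM.semisimplePart_mul hMmul]
      ring)
    (by
      rw [LinearMap.comp_sub, LinearMap.lTensor_sub, LinearMap.sub_comp, hMcomul,
        comul_comp_semisimplePart hMcomul hM])
    hM.exists_sub_pow_apply_eq_zero
  refine ⟨mu, _, hmu, h.algHom_comp hmu φ fun d ↦ ?_⟩
  have hss := hT.map_semisimplePart hM (f := (φ : D →ₐ[k] B).toLinearMap) hMφ d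
  rw [hT.semisimplePart_eq_zero h.exists_pow_eq_zero, LinearMap.zero_apply, map_zero] at hss
  rw [LinearMap.sub_apply, ← hMφ]
  exact (sub_zero (φ (T d))).symm.trans (congrArg (φ (T d) - ·) hss)

/-- Every element of a one parameter unipotent subgroup `S` of `Q(k)` is the image of an element of
a one parameter unipotent subgroup of `H(k)` whose image is contained in `S`. -/
theorem IsOneParamUnipotent.exists_lift [CharZero k] (φ : D →ₐc[k] B) (hφ : Function.Injective φ)
    {S : Subgroup (Points k D k)} (hS : IsOneParamUnipotent S) {q : Points k D k} (hq : q ∈ S) :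
    ∃ S' : Subgroup (Points k B k), IsOneParamUnipotent S' ∧ S'.map (pointsMap φ k) ≤ S ∧
      q ∈ S'.map (pointsMap φ k) := by
  obtain ⟨I, hI, hU, -, hS⟩ := isOneParamUnipotent_iff.1 hS
  have hpoly := exists_polynomial_of_isUnipotent q fun a ↦ by
    let e : k →ₐ[k] AlgebraicClosure k := Algebra.ofId k _
    obtain ⟨P, hP⟩ := hU (Points.mapCoeff e q)
      (fun x hx ↦ (congrArg e ((hS q).1 hq x hx)).trans (map_zero e)) a
    exact ⟨P, fun j ↦ (Points.mapCoeff_pow_apply e q j a).symm.trans (hP j)⟩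
  obtain ⟨lam, hlam⟩ := exists_algHom_of_isUnipotent q hpoly
  have hexp := isExponential_of_eval_eq hlam
  obtain ⟨mu, N, hmu, hmuφ⟩ := hexp.exists_lift φ hφ
  obtain ⟨S', hS', hmem⟩ := hmu.exists_isOneParamUnipotent
  have hval : ∀ τ : k, pointsMap φ k (toConv ((aeval τ).comp mu)) = toConv ((aeval τ).comp lam) := by
    intro τ
    apply WithConv.ext
    ext d
    rw [pointsMap_apply]
    simp [hmuφ]
  refine ⟨S', hS', ?_, ?_⟩
  · rintro _ ⟨g, hg, rfl⟩
    obtain ⟨τ, rfl⟩ := (hmem g).1 hg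
    rw [hval, hS]
    intro x hx
    -- `lam x` vanishes at every natural number `j`, because `qʲ ∈ S`. Hence the whole one parameter
    -- subgroup through `q` stays in `S`.
    have : lam x = 0 := polynomial_eq_of_eval_natCast_eq fun j ↦ by
      rw [← hlam, eval_zero]
      exact (hS _).1 (pow_mem hq j) x hx
    simp [this]
  · refine ⟨_, (hmem _).2 ⟨1, rfl⟩, ?_⟩
    rw [hval]
    apply WithConv.ext
    ext d
    have := hlam d 1
    rw [pow_one, Nat.cast_one] at this
    rw [this]
    simp [coe_aeval_eq_eval]

theorem le_plus {S L : Subgroup (Points k B k)} (hS : IsOneParamUnipotent S) (hL : S ≤ L) :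
    S ≤ plus L :=
  le_sSup ⟨hS, hL⟩

/-- The kernel of `H(k) → Q(k)` is `N(k)`. -/
theorem IsQuotientBy.mem_range_of_pointsMap_eq_one {C : Type u} [CommRing C] [HopfAlgebra k C]
    {φ : D →ₐc[k] B} {π : B →ₐc[k] C} (h : IsQuotientBy φ π) (hπ : Function.Surjective π)
    {b : Points k B k} (hb : pointsMap φ k b = 1) : b ∈ (pointsMap π k).range := by
  have hker : ∀ x, π x = 0 → b.ofConv x = 0 := by
    have hle : RingHom.ker π ≤ RingHom.ker b.ofConv := by
      rw [h.ker_eq, Ideal.map_le_iff_le_comap]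
      intro d hd
      rw [Ideal.mem_comap, RingHom.mem_ker, ← pointsMap_apply, hb, Points.one_apply]
      exact (congrArg (algebraMap k k) hd).trans (map_zero _)
    exact fun x hx ↦ hle hx
  refine ⟨toConv ((π : B →ₐ[k] C).liftOfSurjective hπ b.ofConv hker), ?_⟩
  apply WithConv.ext
  ext x
  rw [pointsMap_apply]
  exact AlgHom.liftOfSurjective_apply (π : B →ₐ[k] C) hπ b.ofConv hker x

end Lift

end AlgGrp

theorem mainTheorem12
    -- a local field `k` of characteristic zero
    {k : Type v} [NontriviallyNormedField k] [LocallyCompactSpace k] [CharZero k]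
    -- the coordinate rings of the groups `G`, `H`, `N` and `Q`
    {A B C D : Type u} [CommRing A] [CommRing B] [CommRing C] [CommRing D]
    [HopfAlgebra k A] [HopfAlgebra k B] [HopfAlgebra k C] [HopfAlgebra k D]
    [Algebra.FiniteType k A] [Algebra.FiniteType k D]
    -- `H` is an algebraic subgroup of `G`
    (ι : A →ₐc[k] B) (hι : Function.Surjective ι)
    -- `N` is a normal algebraic subgroup of `H`
    (π : B →ₐc[k] C) (hπ : Function.Surjective π) (hN : AlgGrp.IsNormal π)
    -- `Q = H / N`
    (φ : D →ₐc[k] B) (hφ : AlgGrp.IsQuotientBy φ π) :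
    (AlgGrp.plusPoints k B).map (AlgGrp.pointsMap ι k) ≤
        AlgGrp.plusPoints k A ⊓ (AlgGrp.pointsMap ι k).range ∧
      AlgGrp.plusPoints k D ≤ (AlgGrp.plusPoints k B).map (AlgGrp.pointsMap φ k) ∧
      ∀ W : Subgroup (AlgGrp.Points k B k),
        (AlgGrp.pointsMap π k).range ≤ W →
        AlgGrp.plus W ≤ (AlgGrp.pointsMap π k).range →
        AlgGrp.plus (W.map (AlgGrp.pointsMap φ k)) = ⊥ := by
  refine ⟨le_inf ?_ (Subgroup.map_le_range _ _), ?_, fun W hNW hW ↦ ?_⟩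
  · rw [Subgroup.map_le_iff_le_comap]
    refine sSup_le fun S hS ↦ ?_
    rw [← Subgroup.map_le_iff_le_comap]
    exact AlgGrp.le_plus (hS.1.map_of_surjective hι) le_top
  · refine sSup_le fun S hS q hq ↦ ?_
    obtain ⟨S', hS', -, hqS'⟩ := hS.1.exists_lift φ hφ.injective hq
    exact Subgroup.map_mono (AlgGrp.le_plus hS' le_top) hqS'
  · refine eq_bot_iff.2 (sSup_le fun S hS q hq ↦ ?_)
    obtain ⟨S', hS', hS'S, b, hb, rfl⟩ := hS.1.exists_lift φ hφ.injective hq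
    -- An element `x` of `S'` and some `w ∈ W` have the same image in `Q(k)`, so `w⁻¹ x` lies in
    -- `N(k)`, which is contained in `W`.
    have hS'W : S' ≤ W := by
      intro x hx
      obtain ⟨w, hw, hwx⟩ := hS.2 (hS'S ⟨x, hx, rfl⟩)
      have h1 : AlgGrp.pointsMap φ k (w⁻¹ * x) = 1 := by
        rw [map_mul, map_inv, hwx, inv_mul_cancel]
      have h2 := W.mul_mem hw (hNW (hφ.mem_range_of_pointsMap_eq_one hπ h1))
      rwa [mul_inv_cancel_left] at h2
    obtain ⟨n, rfl⟩ := hW (AlgGrp.le_plus hS' hS'W hb)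
    rw [Subgroup.mem_bot]
    apply WithConv.ext
    ext d
    rw [AlgGrp.pointsMap_apply, AlgGrp.pointsMap_apply, AlgGrp.Points.one_apply]
    have h1 : π (φ d - algebraMap k B (Coalgebra.counit d)) = 0 := by
      have h2 : φ d - algebraMap k B (Coalgebra.counit d) =
          φ (d - algebraMap k D (Coalgebra.counit d)) := by
        rw [map_sub]
        exact congrArg _ ((φ : D →ₐ[k] B).commutes _).symm
      change _ ∈ RingHom.ker π
      rw [hφ.ker_eq, h2]
      refine Ideal.mem_map_of_mem φ ?_
      simp [RingHom.mem_ker]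
    rw [map_sub, sub_eq_zero] at h1
    rw [h1]
    exact (congrArg n.ofConv ((π : B →ₐ[k] C).commutes _)).trans (n.ofConv.commutes _)
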